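/- **Setting.** Let $d\ge 2$ and let $\vec\mu=(\mu_1,\dots,\mu_d)$ be an Angelesco system: finite positive Borel measures on $\mathbb R$ with compact infinite supports whose convex hulls $\Delta_j=\mathrm{Ch}(\mathrm{supp}\,\mu_j)$ are pairwise disjoint. Let $\vec\kappa\in\mathbb R^d$ with $\kappa_1+\dots+\kappa_d=1$. For $\vec n\in\mathbb Z_+^d$ put $|\vec n|=n_1+\dots+n_d$; write $\mathbb N=\{1,2,\dots\}$, $\vec 1=(1,\dots,1)$, and $\vec e_j$ for the standard basis. *Polynomials.* $P_{\vec n}$ is the monic polynomial of degree $|\vec n|$ with $\int P_{\vec n}(x)x^l\,d\mu_j=0$ for $0\le l<n_j$, $1\le j\le d$. The polynomials $A^{(1)}_{\vec n},\dots,A^{(d)}_{\vec n}$ have $\deg A^{(j)}_{\vec n}\le n_j-1$ ($A^{(j)}_{\vec n}=0$ if $n_j=0$), and $Q_{\vec n}=\sum_jA^{(j)}_{\vec n}d\mu_j$ satisfies $\int x^lQ_{\vec n}=0$ for $0\le l\le|\vec n|-2$ and, if $\vec n\ne 0$, $\int x^{|\vec n|-1}Q_{\vec n}=1$. The recurrence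 coefficients are the real numbers $a_{\vec n,j},b_{\vec n,j}$ ($\vec n\in\mathbb Z_+^d$), with $a_{\vec n,j}=0$ if $n_j=0$, such that for all $j$ $$xP_{\vec n}=P_{\vec n+\vec e_j}+b_{\vec n,j}P_{\vec n}+\sum_{l:\,n_l>0}a_{\vec n,l}P_{\vec n-\vec e_l}\quad(\vec n\in\mathbb Z_+^d),$$ $$xA^{(i)}_{\vec n}=A^{(i)}_{\vec n-\vec e_j}+b_{\vec n-\vec e_j,j}A^{(i)}_{\vec n}+\sum_{l=1}^da_{\vec n,l}A^{(i)}_{\vec n+\vec e_l}\quad(\vec n\in\mathbb N^d,\ 1\le i\le d).$$ Put $\widehat\mu_j(z)=\int\frac{d\mu_j(x)}{z-x}$, $L_{\vec n}(z)=\int\frac{Q_{\vec n}(x)}{z-x}$ and $\gamma_i=-\sum_j\kappa_jA^{(i)}_{\vec 1-\vec e_j}$ (these polynomials are constants). *Tree.* $\mathcal V$ is the vertex set of the infinite rooted tree of lattice paths in $\mathbb N^d$ that start at $\vec 1$ and increase one coordinate by $1$ at each step. $\Pi(Y)$ is the end point of $Y$, the root $O$ is the trivial path, $Y_{(p)}$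 is the parent of $Y\neq O$, $\Pi(Y)=\Pi(Y_{(p)})+\vec e_{\ell_Y}$, and $Y_{(ch),i}$ is the child of $Y$ with $\ell_{Y_{(ch),i}}=i$. Let $V_Y=b_{\Pi(Y_{(p)}),\ell_Y}$ and $W_Y=a_{\Pi(Y_{(p)}),\ell_Y}$ for $Y\ne O$, $V_O=\sum_j\kappa_jb_{\vec 1-\vec e_j,j}$, $W_O=1$, and $$(\mathcal J_{\vec\kappa}f)_Y=W_Y^{1/2}f_{Y_{(p)}}+V_Yf_Y+\sum_{i=1}^dW_{Y_{(ch),i}}^{1/2}f_{Y_{(ch),i}},$$ the first term being absent for $Y=O$. Let $m_Y=\prod_yW_y^{-1/2}$ over the vertices $y$ of the path from $Y$ to $O$ (both included), $l_Y(z)=m_Y^{-1}L_{\Pi(Y)}(z)$, and let $e_Y$ be the delta function at $Y$. **Proposition.** All these objects are well defined: every $P_{\vec n}$ and every vector $(A^{(j)}_{\vec n})_j$ exists and is unique, the recurrence coefficients exist and are unique, $W_Y>0$ for all $Y$, and $\mathcal J_{\vec\kappa}$ is a bounded self-adjoint operator on $\ell^2(\mathcal V)$. For every complex $z\notin\bigl(\bigcup_j\mathrm{supp}\,\mu_j\bigr)\cup\sigma(\mathcal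 J_{\vec\kappa})$ the function $l(z)=(l_Y(z))_{Y\in\mathcal V}$ belongs to $\ell^2(\mathcal V)$, and there $$l(z)=\Bigl(\sum_{j=1}^d\gamma_j\widehat\mu_j(z)\Bigr)(\mathcal J_{\vec\kappa}-z)^{-1}e_O .$$ In particular, for these $z$ one has $\sum_j\gamma_j\widehat\mu_j(z)\neq0$, and the Green's function $G(Y,O,z)=\langle(\mathcal J_{\vec\kappa}-z)^{-1}e_O,e_Y\rangle$ satisfies $$G(Y,O,z)=\Bigl(\sum_{j=1}^d\gamma_j\widehat\mu_j(z)\Bigr)^{-1}l_Y(z)\qquad(Y\in\mathcal V).$$ -/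

import Mathlib

open MeasureTheory Polynomial

noncomputable section

/-- An Angelesco system: finite positive Borel measures on the line with compact, infinite
supports, such that the convex hulls of the supports are pairwise disjoint. (All moments of such
measures are finite.) -/
structure IsAngelescoSystem {d : ℕ} (μ : Fin d → Measure ℝ) : Prop where
  finite : ∀ j, IsFiniteMeasure (μ j)
  infinite_support : ∀ j, (μ j).support.Infinite
  compact_support : ∀ j, IsCompact (μ j).support
  disjoint_hulls : ∀ i j, i ≠ j →
    Disjoint (convexHull ℝ (μ i).support) (convexHull ℝ (μ j).support)

/-- `|n| = n₁ + ⋯ + n_d`. -/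
def multiSize {d : ℕ} (n : Fin d → ℕ) : ℕ := ∑ j, n j

/-- `∫ x^l Q(x)` for the linear form `Q = ∑ⱼ A⁽ʲ⁾ dμⱼ`. -/
def formMoment {d : ℕ} (μ : Fin d → Measure ℝ) (A : Fin d → ℝ[X]) (l : ℕ) : ℝ :=
  ∑ j, ∫ x, (A j).eval x * x ^ l ∂(μ j)

/-- `A` is the normalized vector of type I multiple orthogonal polynomials of index `n`:
`deg A⁽ʲ⁾ ≤ nⱼ - 1` (so `A⁽ʲ⁾ = 0` when `nⱼ = 0`), `∫ x^l Q = 0` for `0 ≤ l ≤ |n| - 2`, and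
`∫ x^(|n|-1) Q = 1` (no normalization for `n = 0`, where all the `A⁽ʲ⁾` are zero). -/
structure IsTypeI {d : ℕ} (μ : Fin d → Measure ℝ) (n : Fin d → ℕ) (A : Fin d → ℝ[X]) :
    Prop where
  degree_lt : ∀ j, (A j).degree < (n j : WithBot ℕ)
  orthogonal : ∀ l : ℕ, l + 2 ≤ multiSize n → formMoment μ A l = 0
  normalized : 0 < multiSize n → formMoment μ A (multiSize n - 1) = 1

/-- `P` is the monic type II multiple orthogonal polynomial of index `n`. -/
structure IsTypeII {d : ℕ} (μ : Fin d → Measure ℝ) (n : Fin d → ℕ) (P : ℝ[X]) : Prop where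
  monic : P.Monic
  natDegree_eq : P.natDegree = multiSize n
  orthogonal : ∀ j, ∀ l < n j, ∫ x, P.eval x * x ^ l ∂(μ j) = 0

/-- The normalized type I polynomials `(A_n⁽¹⁾, …, A_n⁽ᵈ⁾)` (unique when `n` is normal). -/
def typeI {d : ℕ} (μ : Fin d → Measure ℝ) (n : Fin d → ℕ) : Fin d → ℝ[X] :=
  Classical.epsilon (IsTypeI μ n)

/-- The monic type II polynomial `P_n` (unique when `n` is normal). -/
def typeII {d : ℕ} (μ : Fin d → Measure ℝ) (n : Fin d → ℕ) : ℝ[X] :=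
  Classical.epsilon (IsTypeII μ n)

/-- `c = (a, b)` are the coefficients `a_{n,j}`, `b_{n,j}` of the nearest neighbour recurrences of
the type II polynomials (for `n ∈ ℤ₊ᵈ`) and of the type I linear forms (for `n ∈ ℕᵈ`; equality of
the forms is written as equality of the polynomial coefficients of each `dμᵢ`). -/
structure IsRecurrenceCoeff {d : ℕ} (μ : Fin d → Measure ℝ)
    (c : ((Fin d → ℕ) → Fin d → ℝ) × ((Fin d → ℕ) → Fin d → ℝ)) : Prop where
  a_eq_zero : ∀ n j, n j = 0 → c.1 n j = 0
  typeII_rec : ∀ (n : Fin d → ℕ) (j : Fin d),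
    X * typeII μ n = typeII μ (n + Pi.single j 1) + C (c.2 n j) * typeII μ n
      + ∑ l, if n l = 0 then 0 else C (c.1 n l) * typeII μ (n - Pi.single l 1)
  typeI_rec : ∀ n : Fin d → ℕ, (∀ i, 1 ≤ n i) → ∀ j i : Fin d,
    X * typeI μ n i = typeI μ (n - Pi.single j 1) i
      + C (c.2 (n - Pi.single j 1) j) * typeI μ n i
      + ∑ l, C (c.1 n l) * typeI μ (n + Pi.single l 1) i

/-- The recurrence coefficients of the system, as a pair `(a, b)`. -/
def recCoeff {d : ℕ} (μ : Fin d → Measure ℝ) :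
    ((Fin d → ℕ) → Fin d → ℝ) × ((Fin d → ℕ) → Fin d → ℝ) :=
  Classical.epsilon (IsRecurrenceCoeff μ)

/-- The recurrence coefficient `a_{n,j}`. -/
def recA {d : ℕ} (μ : Fin d → Measure ℝ) (n : Fin d → ℕ) (j : Fin d) : ℝ := (recCoeff μ).1 n j

/-- The recurrence coefficient `b_{n,j}`. -/
def recB {d : ℕ} (μ : Fin d → Measure ℝ) (n : Fin d → ℕ) (j : Fin d) : ℝ := (recCoeff μ).2 n j

/-- The Markov function `μ̂(z) = ∫ dμ(x)/(z - x)`. -/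
def markov (μ : Measure ℝ) (z : ℂ) : ℂ := ∫ x, (1 : ℂ) / (z - (x : ℂ)) ∂μ

/-- The function of the second kind `L_n(z) = ∫ Q_n(x)/(z - x)` of the type I form. -/
def secondKindL {d : ℕ} (μ : Fin d → Measure ℝ) (n : Fin d → ℕ) (z : ℂ) : ℂ :=
  ∑ j, ∫ x, (((typeI μ n j).eval x : ℝ) : ℂ) / (z - (x : ℂ)) ∂(μ j)

/-- Vertices of the infinite rooted tree of nearest neighbour lattice paths starting at
`(1, …, 1)`: a vertex is the list of directions of the steps of its path, the last step first.
The root `O` is `[]`, the parent of `l :: Y` is `Y`, and the `l`-th child of `Y` is `l :: Y`. -/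
abbrev TreeVertex (d : ℕ) : Type := List (Fin d)

/-- The projection `Π` of the tree onto `ℕᵈ`: the end point of the path. -/
def treeProj {d : ℕ} : TreeVertex d → (Fin d → ℕ)
  | [] => 1
  | l :: Y => treeProj Y + Pi.single l 1

/-- The potential: `b_{Π(parent), direction}` off the root, `∑ⱼ κⱼ b_{(1,…,1) - eⱼ, j}` at it. -/
def treeV {d : ℕ} (μ : Fin d → Measure ℝ) (κ : Fin d → ℝ) : TreeVertex d → ℝ
  | [] => ∑ j, κ j * recB μ (1 - Pi.single j 1) j
  | l :: Y => recB μ (treeProj Y) l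

/-- The weight: `a_{Π(parent), direction}` off the root, `1` at the root. -/
def treeW {d : ℕ} (μ : Fin d → Measure ℝ) : TreeVertex d → ℝ
  | [] => 1
  | l :: Y => recA μ (treeProj Y) l

/-- The symmetrizer `m_Y = ∏ W_y^{-1/2}` over the path from `Y` to the root, both included
(`Y.tails` lists exactly these vertices). -/
def treeM {d : ℕ} (μ : Fin d → Measure ℝ) (Y : TreeVertex d) : ℝ :=
  (Y.tails.map fun y => (Real.sqrt (treeW μ y))⁻¹).prod

/-- The function `l(z) = m⁻¹ L(z)` on the tree. -/
def treeL {d : ℕ} (μ : Fin d → Measure ℝ) (z : ℂ) (Y : TreeVertex d) : ℂ :=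
  ((treeM μ Y : ℝ) : ℂ)⁻¹ * secondKindL μ (treeProj Y) z

/-- The action of the Jacobi matrix `𝒥_κ` on functions on the vertices. -/
def jacobiAction {d : ℕ} (μ : Fin d → Measure ℝ) (κ : Fin d → ℝ) (f : TreeVertex d → ℂ) :
    TreeVertex d → ℂ
  | [] => (treeV μ κ [] : ℂ) * f [] + ∑ i : Fin d, (Real.sqrt (treeW μ [i]) : ℂ) * f [i]
  | l :: Y => (Real.sqrt (treeW μ (l :: Y)) : ℂ) * f Y + (treeV μ κ (l :: Y) : ℂ) * f (l :: Y)
      + ∑ i : Fin d, (Real.sqrt (treeW μ (i :: l :: Y)) : ℂ) * f (i :: l :: Y)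

/-- The constants `γᵢ = - ∑ⱼ κⱼ A⁽ⁱ⁾_{(1,…,1) - eⱼ}` (these polynomials have degree at most 0). -/
def gammaCoeff {d : ℕ} (μ : Fin d → Measure ℝ) (κ : Fin d → ℝ) (i : Fin d) : ℝ :=
  -∑ j, κ j * (typeI μ (1 - Pi.single j 1) i).coeff 0

/-- The function `∑ⱼ γⱼ μ̂ⱼ(z)`. -/
def gammaMarkov {d : ℕ} (μ : Fin d → Measure ℝ) (κ : Fin d → ℝ) (z : ℂ) : ℂ :=
  ∑ j, (gammaCoeff μ κ j : ℂ) * markov (μ j) z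

/-- The Hilbert space `ℓ²(𝒱)`. -/
abbrev TreeL2 (d : ℕ) : Type := lp (fun _ : TreeVertex d => ℂ) 2

/-- The delta function `e_X` at the vertex `X`. -/
def treeDelta {d : ℕ} (X : TreeVertex d) : TreeL2 d :=
  lp.single 2 X (1 : ℂ)

/-- The operator `(T - z)⁻¹`, meaningful for `z ∉ σ(T)`. -/
def opResolvent {d : ℕ} (T : TreeL2 d →L[ℂ] TreeL2 d) (z : ℂ) : TreeL2 d →L[ℂ] TreeL2 d :=
  Ring.inverse (T - z • (1 : TreeL2 d →L[ℂ] TreeL2 d))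

/-- The Green's function `G(X, Y, z) = ⟨(T - z)⁻¹ e_Y, e_X⟩`; the inner product of the text is
linear in its first argument, Mathlib's is linear in its second one. -/
def greenFunction {d : ℕ} (T : TreeL2 d →L[ℂ] TreeL2 d) (X Y : TreeVertex d) (z : ℂ) : ℂ :=
  inner ℂ (treeDelta X) (opResolvent T z (treeDelta Y))

end

/-! Everything about the polynomials rests on counting zeros. A nonzero polynomial orthogonal to all
powers below `n j` with respect to each `μ j`, even after multiplication by a nonnegative polynomial
weight, has `n j` zeros on each hull; the hulls are disjoint, so it has at least `|n|` zeros
(`eq_zero_of_orthogonal`). Without weight this makes the square linear system for `P_n` invertible,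
and the type I system is its transpose. It also locates the zeros of `P_n`, so the signs of the
norms `∫ P_n x^{n_j} dμ_j` are known. The `a_{n,j}` are quotients of two such norms of equal sign,
hence positive. With a square as weight it shows that no nontrivial combination of `P_n` and
`P_{n+e_j}` has a double real zero, so their Wronskian never vanishes and `P_n / P_{n+e_j}` has
positive residues of sum 1. For this discrete probability measure, carried by the hulls, `b_{n,j}`
is the mean and `b_{n,j}² + ∑ a_{n,l}` the second moment. Hence the coefficients are uniformly
bounded and the Jacobi matrix is a bounded self-adjoint operator `J`.

The type I recurrences say that `J` acts on `m⁻¹ F(Q)`, for any linear functional `F` of the forms,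
as multiplication of the forms by `x`, up to a multiple of `e_O` (`jacobiAction_treeLift`). With the
Cauchy transform as `F`, `(J - z) l = (∑ γ_j μ̂_j) e_O` at every vertex. This alone does not give
the resolvent formula: `l` must be known to lie in `ℓ²`. With moments as `F`, the vectors `t_k = m⁻¹
∫ x^k Q` satisfy `t_0 = 0` and `t_{k+1} = J t_k + g_k e_O`; they lie in `ℓ²` and grow at most
geometrically, so `l = ∑ z^{-k-1} t_k` is in `ℓ²` for large `|z|`. The formula holds there, extends
vertex by vertex through each open half plane by analyticity, and reaches the admissible real points
by continuity.

If `∑ γ_j μ̂_j(z)` were zero, every `L_{Π(Y)}(z)` would vanish. The forms `Q_{Π(Y)}` span all forms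
with `d - 1` vanishing moments, so the Cauchy transform of `p dμ_1` would be a combination of
finitely many moments of `p`, which an infinite support forbids. -/

noncomputable section

/-! ### The moment functional of a compactly supported measure -/

/-- The moment functional `p ↦ ∫ p dμ` on real polynomials. -/
def momentFunctional (μ : Measure ℝ) : ℝ[X] →ₗ[ℝ] ℝ :=
  Polynomial.lsum fun n => (∫ x, x ^ n ∂μ) • LinearMap.id

theorem integrable_of_continuousOn_support {E : Type*} [NormedAddCommGroup E]
    {μ : Measure ℝ} [IsFiniteMeasure μ] (hc : IsCompact μ.support) {f : ℝ → E}
    (hf : ContinuousOn f μ.support) : Integrable f μ := by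
  have h := hf.integrableOn_compact (μ := μ) hc
  have hr : μ.restrict μ.support = μ :=
    Measure.restrict_eq_self_of_ae_mem (show ∀ᵐ x ∂μ, x ∈ μ.support from Measure.support_mem_ae)
  rwa [IntegrableOn, hr] at h

theorem momentFunctional_apply {μ : Measure ℝ} [IsFiniteMeasure μ] (hc : IsCompact μ.support)
    (p : ℝ[X]) : momentFunctional μ p = ∫ x, p.eval x ∂μ := by
  simp only [momentFunctional, Polynomial.lsum_apply, Polynomial.sum_def, LinearMap.smul_apply,
    LinearMap.id_apply, Polynomial.eval_eq_sum]
  rw [integral_finsetSum]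
  · refine Finset.sum_congr rfl fun i _ => ?_
    rw [integral_const_mul, smul_eq_mul, mul_comm]
  · intro i _
    exact integrable_of_continuousOn_support hc (by fun_prop)

theorem eqOn_support_of_ae_eq_zero {μ : Measure ℝ} {f : ℝ → ℝ} (hf : Continuous f)
    (h : f =ᵐ[μ] 0) : ∀ x ∈ μ.support, f x = 0 := by
  intro x hx
  by_contra hne
  have ho : IsOpen {y | f y ≠ 0} := isOpen_ne_fun hf continuous_const
  exact Measure.subset_compl_support_of_isOpen ho h hne hx

/-- If the integral were zero, `p` would vanish almost everywhere, hence by continuity at every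
point of the support, which is infinite. -/
theorem momentFunctional_pos {μ : Measure ℝ} [IsFiniteMeasure μ] (hc : IsCompact μ.support)
    (hi : μ.support.Infinite) {p : ℝ[X]} (hp : p ≠ 0) (h : ∀ x ∈ μ.support, 0 ≤ p.eval x) :
    0 < momentFunctional μ p := by
  rw [momentFunctional_apply hc]
  have hae : 0 ≤ᵐ[μ] fun x => p.eval x :=
    Filter.mem_of_superset Measure.support_mem_ae h
  refine lt_of_le_of_ne (integral_nonneg_of_ae hae) fun h0 => hp ?_
  have hz := (integral_eq_zero_iff_of_nonneg_ae hae
    (integrable_of_continuousOn_support hc p.continuous.continuousOn)).1 h0.symm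
  exact Polynomial.eq_zero_of_infinite_isRoot p
    (hi.mono fun x hx => eqOn_support_of_ae_eq_zero p.continuous hz x hx)

theorem LinearMap.map_mul_eq_zero_of_degree_lt (Λ : ℝ[X] →ₗ[ℝ] ℝ) {f q : ℝ[X]} {m : ℕ}
    (h : ∀ l < m, Λ (f * X ^ l) = 0) (hq : q.degree < m) : Λ (f * q) = 0 := by
  rw [q.as_sum_range_C_mul_X_pow, Finset.mul_sum, map_sum]
  refine Finset.sum_eq_zero fun i _ => ?_
  rw [mul_left_comm, ← Polynomial.smul_eq_C_mul, map_smul]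
  by_cases hi : i < m
  · rw [h i hi, smul_zero]
  · rw [coeff_eq_zero_of_degree_lt (hq.trans_le (by exact_mod_cast not_lt.1 hi)), zero_smul]

/-! ### Counting zeros -/

/-- `S` collects the zeros of odd multiplicity in `I`, built by splitting off one linear factor at a
time: a further factor `X - r` toggles the membership of `r`. Once no zero is left on `I`, the
intermediate value theorem gives a constant sign. -/
theorem exists_roots_const_sign {I : Set ℝ} (hI : IsPreconnected I) (f : ℝ[X]) (hf : f ≠ 0) :
    ∃ S : Finset ℝ, (∀ s ∈ S, s ∈ I ∧ f.IsRoot s) ∧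
      ((∀ x ∈ I, 0 ≤ (f * Lagrange.nodal S id).eval x) ∨
        ∀ x ∈ I, (f * Lagrange.nodal S id).eval x ≤ 0) := by
  induction hn : f.natDegree using Nat.strong_induction_on generalizing f with
  | _ n ih =>
    by_cases hr : ∃ r ∈ I, f.IsRoot r
    · obtain ⟨r, hrI, hr⟩ := hr
      obtain ⟨g, rfl⟩ := dvd_iff_isRoot.2 hr
      have hg : g ≠ 0 := right_ne_zero_of_mul hf
      have hdeg : g.natDegree < n := by
        rw [← hn, natDegree_mul (X_sub_C_ne_zero r) hg, natDegree_X_sub_C]; omega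
      obtain ⟨S, hS, hsign⟩ := ih _ hdeg g hg rfl
      have hroot : ∀ s ∈ S, s ∈ I ∧ ((X - C r) * g).IsRoot s := fun s hs =>
        ⟨(hS s hs).1, by simp [(hS s hs).2.eq_zero]⟩
      by_cases hrS : r ∈ S
      · refine ⟨S.erase r, fun s hs => hroot s (Finset.mem_of_mem_erase hs), ?_⟩
        have : (X - C r) * g * Lagrange.nodal (S.erase r) id = g * Lagrange.nodal S id := by
          rw [Lagrange.nodal_eq_mul_nodal_erase hrS]; simp only [id]; ring
        rwa [this]
      · refine ⟨insert r S, fun s hs => ?_, ?_⟩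
        · rcases Finset.mem_insert.1 hs with rfl | hs
          · exact ⟨hrI, hr⟩
          · exact hroot s hs
        · have : ∀ x, ((X - C r) * g * Lagrange.nodal (insert r S) id).eval x
              = (x - r) ^ 2 * (g * Lagrange.nodal S id).eval x := by
            intro x
            rw [Lagrange.nodal_insert_eq_nodal hrS]
            simp only [id, eval_mul, eval_sub, eval_X, eval_C]; ring
          simp only [this]
          exact hsign.imp (fun h x hx => mul_nonneg (sq_nonneg _) (h x hx))
            fun h x hx => mul_nonpos_of_nonneg_of_nonpos (sq_nonneg _) (h x hx)
    · push Not at hr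
      refine ⟨∅, by simp, ?_⟩
      by_contra hcon
      push Not at hcon
      simp only [Lagrange.nodal_empty, mul_one] at hcon
      obtain ⟨⟨a, ha, ha'⟩, b, hb, hb'⟩ := hcon
      obtain ⟨c, hc, hc'⟩ := hI.intermediate_value ha hb f.continuous.continuousOn
        ⟨ha'.le, hb'.le⟩
      exact hr c hc hc'

/-- With fewer than `m` sign changes, `f * w` would be orthogonal to the nodal polynomial of these
changes, although the product has constant sign on the hull. The weight later absorbs the square of
a double zero. -/
theorem exists_roots_of_orthogonal {μ : Measure ℝ} [IsFiniteMeasure μ]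
    (hc : IsCompact μ.support) (hi : μ.support.Infinite) {f w : ℝ[X]} (hf : f ≠ 0) (hw : w ≠ 0)
    (hw0 : ∀ x, 0 ≤ w.eval x) {m : ℕ} (h : ∀ l < m, momentFunctional μ (f * w * X ^ l) = 0) :
    ∃ S : Finset ℝ, (∀ s ∈ S, s ∈ convexHull ℝ μ.support ∧ f.IsRoot s) ∧ m ≤ S.card := by
  obtain ⟨S, hS, hsign⟩ :=
    exists_roots_const_sign (convex_convexHull ℝ μ.support).isPreconnected f hf
  refine ⟨S, hS, ?_⟩
  by_contra! hlt
  have h0 : momentFunctional μ (f * w * Lagrange.nodal S id) = 0 :=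
    LinearMap.map_mul_eq_zero_of_degree_lt _ h (by rw [Lagrange.degree_nodal]; exact_mod_cast hlt)
  have hne : f * w * Lagrange.nodal S id ≠ 0 :=
    mul_ne_zero (mul_ne_zero hf hw) Lagrange.nodal_ne_zero
  have heq : ∀ x, (f * w * Lagrange.nodal S id).eval x
      = w.eval x * (f * Lagrange.nodal S id).eval x := by
    intro x; simp only [eval_mul]; ring
  rcases hsign with hs | hs
  · refine (momentFunctional_pos hc hi hne fun x hx => ?_).ne' h0
    rw [heq]
    exact mul_nonneg (hw0 x) (hs x (subset_convexHull ℝ _ hx))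
  · refine (momentFunctional_pos hc hi (neg_ne_zero.2 hne) fun x hx => ?_).ne' (by simp [h0])
    rw [eval_neg, heq, neg_nonneg]
    exact mul_nonpos_of_nonneg_of_nonpos (hw0 x) (hs x (subset_convexHull ℝ _ hx))

namespace IsAngelescoSystem

variable {d : ℕ} {μ : Fin d → Measure ℝ}

/-- A polynomial satisfying the (weighted) orthogonality relations of index `n` has at least `nⱼ`
zeros on each interval. -/
theorem exists_roots (hμ : IsAngelescoSystem μ) {n : Fin d → ℕ} {f w : ℝ[X]} (hf : f ≠ 0)
    (hw : w ≠ 0) (hw0 : ∀ x, 0 ≤ w.eval x)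
    (h : ∀ j, ∀ l < n j, momentFunctional (μ j) (f * w * X ^ l) = 0) :
    ∃ S : Fin d → Finset ℝ, (∀ j, ∀ s ∈ S j, s ∈ convexHull ℝ (μ j).support ∧ f.IsRoot s) ∧
      (∀ j, n j ≤ (S j).card) ∧ Pairwise (Function.onFun Disjoint S) := by
  have := fun j => (have := hμ.finite j
    exists_roots_of_orthogonal (hμ.compact_support j) (hμ.infinite_support j) hf hw hw0 (h j))
  choose S hS hcard using this
  refine ⟨S, hS, hcard, fun i j hij => Finset.disjoint_left.2 fun s hi hj => ?_⟩
  exact Set.disjoint_left.1 (hμ.disjoint_hulls i j hij) (hS i s hi).1 (hS j s hj).1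

/-- Weighted normality of all multi-indices. -/
theorem eq_zero_of_orthogonal (hμ : IsAngelescoSystem μ) {n : Fin d → ℕ} {f w : ℝ[X]}
    (hw : w ≠ 0) (hw0 : ∀ x, 0 ≤ w.eval x) (hdeg : f.degree < multiSize n)
    (h : ∀ j, ∀ l < n j, momentFunctional (μ j) (f * w * X ^ l) = 0) : f = 0 := by
  by_contra hf
  obtain ⟨S, hS, hcard, hdisj⟩ := hμ.exists_roots hf hw hw0 h
  have hsub : Finset.univ.biUnion S ⊆ f.roots.toFinset := by
    intro s hs
    obtain ⟨j, -, hj⟩ := Finset.mem_biUnion.1 hs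
    simpa [hf] using (hS j s hj).2
  have h1 := (Finset.card_le_card hsub).trans (f.roots.toFinset_card_le.trans f.card_roots')
  rw [Finset.card_biUnion fun i _ j _ hij => hdisj hij] at h1
  have h2 : multiSize n ≤ f.natDegree :=
    (Finset.sum_le_sum fun j _ => hcard j).trans h1
  exact absurd hdeg (not_lt.2 ((Nat.cast_le.2 h2).trans (degree_eq_natDegree hf).ge))

end IsAngelescoSystem

/-! ### Multi-indices -/

section MultiIndex

variable {d : ℕ}

theorem multiSize_add_single (n : Fin d → ℕ) (j : Fin d) :
    multiSize (n + Pi.single j 1) = multiSize n + 1 := by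
  simp [multiSize, Finset.sum_add_distrib]

theorem sub_single_add_single {n : Fin d → ℕ} {j : Fin d} (h : n j ≠ 0) :
    n - Pi.single j 1 + Pi.single j 1 = n := by
  ext i
  rcases eq_or_ne i j with rfl | hij
  · simp; omega
  · simp [hij]

theorem multiSize_sub_single {n : Fin d → ℕ} {j : Fin d} (h : n j ≠ 0) :
    multiSize (n - Pi.single j 1) + 1 = multiSize n := by
  rw [← multiSize_add_single, sub_single_add_single h]

theorem multiSize_of_forall_one_le {n : Fin d → ℕ} (h : ∀ i, 1 ≤ n i) : d ≤ multiSize n := by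
  simpa [multiSize] using Finset.sum_le_sum fun i (_ : i ∈ Finset.univ) => h i

theorem le_multiSize (n : Fin d → ℕ) (j : Fin d) : n j ≤ multiSize n :=
  Finset.single_le_sum (f := n) (fun _ _ => Nat.zero_le _) (Finset.mem_univ j)

theorem treeProj_pos (Y : TreeVertex d) (i : Fin d) : 1 ≤ treeProj Y i := by
  induction Y with
  | nil => simp [treeProj]
  | cons l Y ih => simpa [treeProj] using ih.trans (Nat.le_add_right _ _)

end MultiIndex

/-- The linear functional `q ↦ ∫ q Q` of the form `Q = ∑ⱼ A⁽ʲ⁾ dμⱼ`. -/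
def formFunctional {d : ℕ} (μ : Fin d → Measure ℝ) (A : Fin d → ℝ[X]) : ℝ[X] →ₗ[ℝ] ℝ :=
  ∑ j, momentFunctional (μ j) ∘ₗ LinearMap.mulLeft ℝ (A j)

theorem formFunctional_apply {d : ℕ} (μ : Fin d → Measure ℝ) (A : Fin d → ℝ[X]) (q : ℝ[X]) :
    formFunctional μ A q = ∑ j, momentFunctional (μ j) (A j * q) := by
  simp [formFunctional]

theorem LinearMap.map_mul_eq_sum_coeff (Λ : ℝ[X] →ₗ[ℝ] ℝ) (f : ℝ[X]) {q : ℝ[X]} {m : ℕ}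
    (hq : q.degree < m) :
    Λ (f * q) = ∑ l ∈ Finset.range m, q.coeff l * Λ (f * X ^ l) := by
  rcases eq_or_ne q 0 with rfl | h0
  · simp
  conv_lhs => rw [q.as_sum_range' m ((natDegree_lt_iff_degree_lt h0).2 hq)]
  rw [Finset.mul_sum, map_sum]
  refine Finset.sum_congr rfl fun i _ => ?_
  rw [← C_mul_X_pow_eq_monomial, mul_left_comm, ← Polynomial.smul_eq_C_mul, map_smul, smul_eq_mul]

theorem Polynomial.Monic.degree_sub_X_pow_lt {P : ℝ[X]} (h : P.Monic) :
    (P - X ^ P.natDegree).degree < (P.natDegree : WithBot ℕ) := by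
  have := degree_sub_lt_left (p := P) (q := X ^ P.natDegree)
    (by rw [degree_X_pow, degree_eq_natDegree h.ne_zero]) h.ne_zero (by simp [h.leadingCoeff])
  rwa [degree_eq_natDegree h.ne_zero] at this

/-! ### Existence and uniqueness of the multiple orthogonal polynomials -/

namespace IsAngelescoSystem

variable {d : ℕ} {μ : Fin d → Measure ℝ}

theorem integral_eval_mul_pow (hμ : IsAngelescoSystem μ) (j : Fin d) (P : ℝ[X]) (l : ℕ) :
    ∫ x, P.eval x * x ^ l ∂(μ j) = momentFunctional (μ j) (P * X ^ l) := by
  have := hμ.finite j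
  rw [momentFunctional_apply (hμ.compact_support j)]
  simp

theorem formMoment_eq (hμ : IsAngelescoSystem μ) (A : Fin d → ℝ[X]) (l : ℕ) :
    formMoment μ A l = formFunctional μ A (X ^ l) := by
  simp only [formMoment, formFunctional_apply, hμ.integral_eval_mul_pow]

theorem eq_zero_of_degree_lt (hμ : IsAngelescoSystem μ) {n : Fin d → ℕ} {f : ℝ[X]}
    (hdeg : f.degree < multiSize n)
    (h : ∀ j, ∀ l < n j, momentFunctional (μ j) (f * X ^ l) = 0) : f = 0 :=
  hμ.eq_zero_of_orthogonal (w := 1) one_ne_zero (by simp) hdeg (by simpa using h)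

/-- There are `|n|` unknowns and `|n|` conditions, and normality is injectivity. -/
theorem exists_degree_lt_of_moments (hμ : IsAngelescoSystem μ) (n : Fin d → ℕ)
    (c : Fin d → ℕ → ℝ) : ∃ f : ℝ[X], f.degree < multiSize n ∧
      ∀ j, ∀ l < n j, momentFunctional (μ j) (f * X ^ l) = c j l := by
  let Φ : degreeLT ℝ (multiSize n) →ₗ[ℝ] ((Σ j, Fin (n j)) → ℝ) :=
    LinearMap.pi fun p => momentFunctional (μ p.1) ∘ₗ LinearMap.mulRight ℝ (X ^ (p.2 : ℕ)) ∘ₗ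
      (degreeLT ℝ (multiSize n)).subtype
  have hinj : Function.Injective Φ := by
    rw [← LinearMap.ker_eq_bot, LinearMap.ker_eq_bot']
    intro f hf
    refine Subtype.ext (hμ.eq_zero_of_degree_lt (mem_degreeLT.1 f.2) fun j l hl => ?_)
    exact congrFun hf ⟨j, l, hl⟩
  have : Module.Finite ℝ (degreeLT ℝ (multiSize n)) :=
    Module.Finite.equiv (degreeLTEquiv ℝ (multiSize n)).symm
  have hrank : Module.finrank ℝ (degreeLT ℝ (multiSize n))
      = Module.finrank ℝ ((Σ j, Fin (n j)) → ℝ) := by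
    rw [(degreeLTEquiv ℝ (multiSize n)).finrank_eq, Module.finrank_fin_fun,
      Module.finrank_fintype_fun_eq_card]
    simp [multiSize]
  obtain ⟨f, hf⟩ := (LinearMap.injective_iff_surjective_of_finrank_eq_finrank hrank).1 hinj
    fun p => c p.1 p.2
  exact ⟨f, mem_degreeLT.1 f.2, fun j l hl => congrFun hf ⟨j, l, hl⟩⟩

/-- This is the transpose of the type II system. Test the form against a polynomial `f` of degree
below `|n|` whose moments are the coefficients of `A`: the pairing is zero by hypothesis and equals
the sum of the squares of these coefficients. -/
theorem form_eq_zero (hμ : IsAngelescoSystem μ) {n : Fin d → ℕ} {A : Fin d → ℝ[X]}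
    (hdeg : ∀ j, (A j).degree < n j)
    (h : ∀ l < multiSize n, formFunctional μ A (X ^ l) = 0) : A = 0 := by
  obtain ⟨f, hf, hfm⟩ := hμ.exists_degree_lt_of_moments n fun j l => (A j).coeff l
  have h0 : formFunctional μ A (1 * f) = 0 :=
    LinearMap.map_mul_eq_zero_of_degree_lt _ (by simpa using h) hf
  rw [one_mul, formFunctional_apply] at h0
  have h1 : ∀ j, momentFunctional (μ j) (A j * f) = ∑ l ∈ Finset.range (n j), (A j).coeff l ^ 2 := by
    intro j
    rw [mul_comm, LinearMap.map_mul_eq_sum_coeff _ _ (hdeg j)]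
    refine Finset.sum_congr rfl fun l hl => ?_
    rw [hfm j l (Finset.mem_range.1 hl), sq]
  simp only [h1] at h0
  rw [Finset.sum_eq_zero_iff_of_nonneg fun j _ => Finset.sum_nonneg fun l _ => sq_nonneg _] at h0
  ext j l
  by_cases hl : l < n j
  · have := (Finset.sum_eq_zero_iff_of_nonneg fun l _ => sq_nonneg _).1 (h0 j (Finset.mem_univ j)) l
      (Finset.mem_range.2 hl)
    simpa using this
  · simpa using coeff_eq_zero_of_degree_lt ((hdeg j).trans_le (by exact_mod_cast not_lt.1 hl))

theorem exists_form_of_moments (hμ : IsAngelescoSystem μ) (n : Fin d → ℕ) (c : ℕ → ℝ) :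
    ∃ A : Fin d → ℝ[X], (∀ j, (A j).degree < n j) ∧
      ∀ l < multiSize n, formFunctional μ A (X ^ l) = c l := by
  let Ψ : (∀ j, degreeLT ℝ (n j)) →ₗ[ℝ] (Fin (multiSize n) → ℝ) :=
    LinearMap.pi fun l => ∑ j, momentFunctional (μ j) ∘ₗ LinearMap.mulRight ℝ (X ^ (l : ℕ)) ∘ₗ
      (degreeLT ℝ (n j)).subtype ∘ₗ LinearMap.proj j
  have hΨ : ∀ A l, Ψ A l = formFunctional μ (fun j => A j) (X ^ (l : ℕ)) := by
    intro A l; simp [Ψ, formFunctional_apply]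
  have hinj : Function.Injective Ψ := by
    rw [← LinearMap.ker_eq_bot, LinearMap.ker_eq_bot']
    intro A hA
    have := hμ.form_eq_zero (n := n) (A := fun j => A j) (fun j => mem_degreeLT.1 (A j).2)
      fun l hl => by rw [← hΨ A ⟨l, hl⟩, hA]; rfl
    funext j
    exact Subtype.ext (congrFun this j)
  have : ∀ j, Module.Finite ℝ (degreeLT ℝ (n j)) := fun j =>
    Module.Finite.equiv (degreeLTEquiv ℝ (n j)).symm
  have : ∀ j, Module.Free ℝ (degreeLT ℝ (n j)) := fun j => inferInstance
  have hrank : Module.finrank ℝ (∀ j, degreeLT ℝ (n j))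
      = Module.finrank ℝ (Fin (multiSize n) → ℝ) := by
    rw [Module.finrank_pi_fintype]
    simp only [(degreeLTEquiv ℝ _).finrank_eq, Module.finrank_fin_fun]
    rfl
  obtain ⟨A, hA⟩ := (LinearMap.injective_iff_surjective_of_finrank_eq_finrank hrank).1 hinj
    fun l => c l
  exact ⟨fun j => A j, fun j => mem_degreeLT.1 (A j).2, fun l hl => by
    rw [← hΨ A ⟨l, hl⟩, hA]⟩

theorem existsUnique_typeII (hμ : IsAngelescoSystem μ) (n : Fin d → ℕ) :
    ∃! P, IsTypeII μ n P := by
  obtain ⟨f, hf, hfm⟩ := hμ.exists_degree_lt_of_moments n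
    fun j l => momentFunctional (μ j) (X ^ multiSize n * X ^ l)
  have hmonic : (X ^ multiSize n - f).Monic :=
    monic_X_pow_sub hf
  refine ⟨X ^ multiSize n - f, ⟨hmonic, ?_, fun j l hl => ?_⟩, fun Q hQ => ?_⟩
  · rw [natDegree_eq_of_degree_eq (degree_sub_eq_left_of_degree_lt (by rwa [degree_X_pow])),
      natDegree_X_pow]
  · rw [hμ.integral_eval_mul_pow, sub_mul, map_sub, hfm j l hl, sub_self]
  · have : Q - (X ^ multiSize n - f) = 0 := by
      refine hμ.eq_zero_of_degree_lt (n := n) ?_ fun j l hl => ?_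
      · have h1 := hQ.monic.degree_sub_X_pow_lt
        rw [hQ.natDegree_eq] at h1
        rw [← sub_add]
        exact (degree_add_le _ _).trans_lt (max_lt h1 hf)
      · rw [sub_mul, sub_mul, map_sub, map_sub, hfm j l hl, sub_self, sub_zero,
          ← hμ.integral_eval_mul_pow, hQ.orthogonal j l hl]
    exact sub_eq_zero.1 this

theorem existsUnique_typeI (hμ : IsAngelescoSystem μ) (n : Fin d → ℕ) :
    ∃! A, IsTypeI μ n A := by
  obtain ⟨A, hdeg, hA⟩ := hμ.exists_form_of_moments n
    fun l => if l + 1 = multiSize n then 1 else 0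
  refine ⟨A, ⟨hdeg, fun l hl => ?_, fun h0 => ?_⟩, fun B hB => ?_⟩
  · rw [hμ.formMoment_eq, hA l (by omega), if_neg (by omega)]
  · rw [hμ.formMoment_eq, hA _ (by omega), if_pos (by omega)]
  · have : B - A = 0 := by
      refine hμ.form_eq_zero (n := n) (fun j => ?_) fun l hl => ?_
      · exact (degree_sub_le _ _).trans_lt (max_lt (hB.degree_lt j) (hdeg j))
      · have h1 : formFunctional μ (B - A) (X ^ l)
            = formFunctional μ B (X ^ l) - formFunctional μ A (X ^ l) := by
          simp [formFunctional_apply, sub_mul]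
        rw [h1, hA l hl, ← hμ.formMoment_eq]
        split_ifs with h
        · rw [← hB.normalized (by omega), sub_eq_zero]
          congr 1; omega
        · rw [hB.orthogonal l (by omega), sub_zero]
    exact sub_eq_zero.1 this

theorem isTypeII_typeII (hμ : IsAngelescoSystem μ) (n : Fin d → ℕ) :
    IsTypeII μ n (typeII μ n) :=
  Classical.epsilon_spec (hμ.existsUnique_typeII n).exists

theorem isTypeI_typeI (hμ : IsAngelescoSystem μ) (n : Fin d → ℕ) :
    IsTypeI μ n (typeI μ n) :=
  Classical.epsilon_spec (hμ.existsUnique_typeI n).exists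

end IsAngelescoSystem

/-- `∫ P_n x^{nⱼ} dμⱼ`. -/
def typeIINorm {d : ℕ} (μ : Fin d → Measure ℝ) (n : Fin d → ℕ) (j : Fin d) : ℝ :=
  momentFunctional (μ j) (typeII μ n * X ^ n j)

/-- The coefficient `a_{n,j}` as a quotient of norms of type II polynomials. -/
def normRatio {d : ℕ} (μ : Fin d → Measure ℝ) (n : Fin d → ℕ) (j : Fin d) : ℝ :=
  if n j = 0 then 0 else typeIINorm μ n j / typeIINorm μ (n - Pi.single j 1) j

/-- The coefficient `b_{n,j}` read off from the subleading coefficients of type II polynomials. -/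
def subleadingDiff {d : ℕ} (μ : Fin d → Measure ℝ) (n : Fin d → ℕ) (j : Fin d) : ℝ :=
  (X * typeII μ n - typeII μ (n + Pi.single j 1)).coeff (multiSize n)

section FormFunctional

variable {d : ℕ} (μ : Fin d → Measure ℝ)

theorem formFunctional_sub (A B : Fin d → ℝ[X]) (q : ℝ[X]) :
    formFunctional μ (fun i => A i - B i) q = formFunctional μ A q - formFunctional μ B q := by
  simp [formFunctional_apply, sub_mul]

theorem formFunctional_C_mul (c : ℝ) (A : Fin d → ℝ[X]) (q : ℝ[X]) :
    formFunctional μ (fun i => C c * A i) q = c * formFunctional μ A q := by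
  simp only [formFunctional_apply, Finset.mul_sum]
  refine Finset.sum_congr rfl fun i _ => ?_
  rw [mul_assoc, ← smul_eq_C_mul, map_smul, smul_eq_mul]

theorem formFunctional_X_mul (A : Fin d → ℝ[X]) (q : ℝ[X]) :
    formFunctional μ (fun i => X * A i) q = formFunctional μ A (X * q) := by
  simp only [formFunctional_apply]
  refine Finset.sum_congr rfl fun i _ => ?_
  congr 1; ring

theorem formFunctional_sum {ι : Type*} (s : Finset ι) (A : ι → Fin d → ℝ[X]) (q : ℝ[X]) :
    formFunctional μ (fun i => ∑ l ∈ s, A l i) q = ∑ l ∈ s, formFunctional μ (A l) q := by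
  simp only [formFunctional_apply, Finset.sum_mul, map_sum]
  exact Finset.sum_comm

end FormFunctional

/-! ### Zeros of the type II polynomials and signs of their norms -/

namespace IsAngelescoSystem

variable {d : ℕ} {μ : Fin d → Measure ℝ}

/-- On the connected product of two hulls the difference `x - s` never vanishes, so it has a fixed
sign. -/
theorem exists_sign (hμ : IsAngelescoSystem μ) : ∃ σ : Fin d → Fin d → ℝ, ∀ k j, k ≠ j →
    ∀ s ∈ convexHull ℝ (μ k).support, ∀ x ∈ convexHull ℝ (μ j).support, 0 < σ k j * (x - s) := by
  have key : ∀ k j, ∃ c : ℝ, k ≠ j → ∀ s ∈ convexHull ℝ (μ k).support,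
      ∀ x ∈ convexHull ℝ (μ j).support, 0 < c * (x - s) := by
    intro k j
    by_cases hkj : k = j
    · exact ⟨0, fun h => absurd hkj h⟩
    by_contra! hcon
    obtain ⟨-, s, hs, x, hx, h1⟩ := hcon 1
    obtain ⟨-, t, ht, y, hy, h2⟩ := hcon (-1)
    have hpre : IsPreconnected (convexHull ℝ (μ k).support ×ˢ convexHull ℝ (μ j).support) :=
      (convex_convexHull ℝ _).isPreconnected.prod (convex_convexHull ℝ _).isPreconnected
    obtain ⟨⟨u, v⟩, ⟨hu, hv⟩, huv⟩ := hpre.intermediate_value (f := fun p : ℝ × ℝ => p.2 - p.1)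
      (a := (s, x)) (b := (t, y)) ⟨hs, hx⟩ ⟨ht, hy⟩ (by fun_prop)
      (show (0 : ℝ) ∈ Set.Icc (x - s) (y - t) from ⟨by linarith, by linarith⟩)
    have : v = u := by simpa [sub_eq_zero] using huv
    subst this
    exact Set.disjoint_left.1 (hμ.disjoint_hulls k j hkj) hu hv
  choose σ hσ using key
  exact ⟨σ, hσ⟩

theorem typeII_monic (hμ : IsAngelescoSystem μ) (n : Fin d → ℕ) : (typeII μ n).Monic :=
  (hμ.isTypeII_typeII n).monic

theorem natDegree_typeII (hμ : IsAngelescoSystem μ) (n : Fin d → ℕ) :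
    (typeII μ n).natDegree = multiSize n :=
  (hμ.isTypeII_typeII n).natDegree_eq

theorem coeff_typeII_multiSize (hμ : IsAngelescoSystem μ) (n : Fin d → ℕ) :
    (typeII μ n).coeff (multiSize n) = 1 := by
  rw [← hμ.natDegree_typeII n]; exact (hμ.typeII_monic n).coeff_natDegree

theorem coeff_typeII_eq_zero (hμ : IsAngelescoSystem μ) {n : Fin d → ℕ} {m : ℕ}
    (h : multiSize n < m) : (typeII μ n).coeff m = 0 :=
  coeff_eq_zero_of_natDegree_lt (by rwa [hμ.natDegree_typeII])

theorem moment_typeII (hμ : IsAngelescoSystem μ) {n : Fin d → ℕ} {j : Fin d} {l : ℕ}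
    (hl : l < n j) : momentFunctional (μ j) (typeII μ n * X ^ l) = 0 := by
  rw [← hμ.integral_eval_mul_pow]
  exact (hμ.isTypeII_typeII n).orthogonal j l hl

theorem moment_typeII_mul (hμ : IsAngelescoSystem μ) {n : Fin d → ℕ} {j : Fin d} {q : ℝ[X]}
    (hq : q.degree < n j) : momentFunctional (μ j) (typeII μ n * q) = 0 :=
  LinearMap.map_mul_eq_zero_of_degree_lt _ (fun _ hl => hμ.moment_typeII hl) hq

/-- The polynomial `P_n` has `nⱼ` simple zeros on the `j`-th interval and no others. -/
theorem typeII_eq_prod_nodal (hμ : IsAngelescoSystem μ) (n : Fin d → ℕ) :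
    ∃ S : Fin d → Finset ℝ, (∀ j, ∀ s ∈ S j, s ∈ convexHull ℝ (μ j).support) ∧
      (∀ j, (S j).card = n j) ∧ Pairwise (Function.onFun Disjoint S) ∧
      typeII μ n = ∏ j, Lagrange.nodal (S j) id := by
  have hne : typeII μ n ≠ 0 := (hμ.typeII_monic n).ne_zero
  obtain ⟨S, hS, hcard, hdisj⟩ := hμ.exists_roots (n := n) (w := 1) hne one_ne_zero (by simp)
    fun j l hl => by rw [mul_one]; exact hμ.moment_typeII hl
  have hprod : ∏ j, Lagrange.nodal (S j) (id : ℝ → ℝ)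
      = Lagrange.nodal (Finset.univ.biUnion S) id := by
    simp only [Lagrange.nodal_eq]
    rw [Finset.prod_biUnion fun i _ j _ hij => hdisj hij]
  have hdvd : Lagrange.nodal (Finset.univ.biUnion S) id ∣ typeII μ n := by
    rw [Lagrange.nodal_eq, Finset.prod_eq_multiset_prod]
    refine (Multiset.prod_X_sub_C_dvd_iff_le_roots hne _).2 ?_
    rw [Finset.val_le_iff_val_subset]
    intro s hs
    obtain ⟨j, -, hj⟩ := Finset.mem_biUnion.1 (Finset.mem_def.2 hs)
    exact (mem_roots hne).2 (hS j s hj).2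
  have hsum : (Finset.univ.biUnion S).card = ∑ j, (S j).card :=
    Finset.card_biUnion fun i _ j _ hij => hdisj hij
  have hge : multiSize n ≤ ∑ j, (S j).card := Finset.sum_le_sum fun j _ => hcard j
  have hle : ∑ j, (S j).card ≤ multiSize n := by
    have := natDegree_le_of_dvd hdvd hne
    rwa [Lagrange.natDegree_nodal, hμ.natDegree_typeII, hsum] at this
  refine ⟨S, fun j s hs => (hS j s hs).1, fun j => ?_, hdisj, ?_⟩
  · exact ((Finset.sum_eq_sum_iff_of_le fun j _ => hcard j).1 (le_antisymm hge hle) j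
      (Finset.mem_univ j)).symm
  · rw [hprod]
    refine eq_of_monic_of_dvd_of_natDegree_le Lagrange.nodal_monic (hμ.typeII_monic n) hdvd ?_
    rw [Lagrange.natDegree_nodal, hμ.natDegree_typeII, hsum]
    exact hge

/-- By orthogonality `x^{n_j}` may be replaced by the monic polynomial with the zeros of `P_n` on
the `j`-th hull. The integrand is then a square times factors `x - s` with `s` in other hulls, whose
signs are known. The resulting sign does not involve `n j`, so it is the same for `n` and `n - e_j`.
-/
theorem typeIINorm_sign (hμ : IsAngelescoSystem μ) {σ : Fin d → Fin d → ℝ}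
    (hσ : ∀ k j, k ≠ j → ∀ s ∈ convexHull ℝ (μ k).support,
      ∀ x ∈ convexHull ℝ (μ j).support, 0 < σ k j * (x - s)) (n : Fin d → ℕ) (j : Fin d) :
    0 < (∏ k ∈ Finset.univ.erase j, σ k j ^ n k) * typeIINorm μ n j := by
  obtain ⟨S, hS, hcard, -, hP⟩ := hμ.typeII_eq_prod_nodal n
  have := hμ.finite j
  set e := ∏ k ∈ Finset.univ.erase j, σ k j ^ n k with he
  have h1 : typeIINorm μ n j
      = momentFunctional (μ j) (typeII μ n * Lagrange.nodal (S j) id) := by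
    have hdeg : (Lagrange.nodal (S j) (id : ℝ → ℝ) - X ^ n j).degree < (n j : WithBot ℕ) := by
      have := (Lagrange.nodal_monic (s := S j) (v := (id : ℝ → ℝ))).degree_sub_X_pow_lt
      rwa [Lagrange.natDegree_nodal, hcard] at this
    have h0 := hμ.moment_typeII_mul hdeg
    rw [mul_sub, map_sub, sub_eq_zero] at h0
    exact h0.symm
  have heval : ∀ x, (C e * (typeII μ n * Lagrange.nodal (S j) id)).eval x
      = (Lagrange.nodal (S j) id).eval x ^ 2 *
        ∏ k ∈ Finset.univ.erase j, ∏ s ∈ S k, (σ k j * (x - s)) := by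
    intro x
    rw [hP, ← Finset.mul_prod_erase _ _ (Finset.mem_univ j)]
    simp only [eval_mul, eval_C, eval_prod, Finset.prod_mul_distrib, Finset.prod_const, hcard,
      Lagrange.eval_nodal, id, ← he]
    ring
  have hpos : ∀ x ∈ (μ j).support,
      0 < ∏ k ∈ Finset.univ.erase j, ∏ s ∈ S k, (σ k j * (x - s)) := fun x hx =>
    Finset.prod_pos fun k hk => Finset.prod_pos fun s hs =>
      hσ k j (Finset.ne_of_mem_erase hk) s (hS k s hs) x (subset_convexHull ℝ _ hx)
  rw [h1, ← smul_eq_mul, ← map_smul, smul_eq_C_mul]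
  refine momentFunctional_pos (hμ.compact_support j) (hμ.infinite_support j) ?_ fun x hx => ?_
  -- The constant is nonzero: at a support point outside `S j` the right side of `heval` is
  -- positive.
  · refine mul_ne_zero (C_ne_zero.2 fun h0 => ?_)
      (mul_ne_zero (hμ.typeII_monic n).ne_zero Lagrange.nodal_ne_zero)
    obtain ⟨x, hx, hx'⟩ := (hμ.infinite_support j).exists_notMem_finset (S j)
    have h2 := heval x
    rw [h0, C_0, zero_mul, eval_zero] at h2
    have h3 : (Lagrange.nodal (S j) id).eval x ≠ 0 := by
      rw [Lagrange.eval_nodal, Finset.prod_ne_zero_iff]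
      intro s hs h4
      exact hx' ((sub_eq_zero.1 h4) ▸ hs)
    exact (mul_ne_zero (pow_ne_zero 2 h3) (hpos x hx).ne') h2.symm
  · rw [heval]
    exact mul_nonneg (sq_nonneg _) (hpos x hx).le

theorem typeIINorm_ne_zero (hμ : IsAngelescoSystem μ) (n : Fin d → ℕ) (j : Fin d) :
    typeIINorm μ n j ≠ 0 := by
  obtain ⟨σ, hσ⟩ := hμ.exists_sign
  exact right_ne_zero_of_mul (hμ.typeIINorm_sign hσ n j).ne'

theorem normRatio_pos (hμ : IsAngelescoSystem μ) {n : Fin d → ℕ} {j : Fin d} (h : n j ≠ 0) :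
    0 < normRatio μ n j := by
  obtain ⟨σ, hσ⟩ := hμ.exists_sign
  have h1 := hμ.typeIINorm_sign hσ n j
  have h2 := hμ.typeIINorm_sign hσ (n - Pi.single j 1) j
  have he : ∏ k ∈ Finset.univ.erase j, σ k j ^ (n - Pi.single j 1 : Fin d → ℕ) k
      = ∏ k ∈ Finset.univ.erase j, σ k j ^ n k :=
    Finset.prod_congr rfl fun k hk => by simp [Finset.ne_of_mem_erase hk]
  rw [he] at h2
  rw [normRatio, if_neg h, ← mul_div_mul_left _ _ (left_ne_zero_of_mul h1.ne')]
  exact div_pos h1 h2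

/-! ### Recurrences of the type II polynomials -/

theorem moment_sum_typeII_eq_zero (hμ : IsAngelescoSystem μ) (a : Fin d → ℝ) {n : Fin d → ℕ}
    {k : Fin d} {l : ℕ} (hl : l + 1 < n k) :
    momentFunctional (μ k) ((∑ i, if n i = 0 then 0 else
      C (a i) * typeII μ (n - Pi.single i 1)) * X ^ l) = 0 := by
  rw [Finset.sum_mul, map_sum]
  refine Finset.sum_eq_zero fun i _ => ?_
  split_ifs with hi
  · simp
  · rw [mul_assoc, ← smul_eq_C_mul, map_smul, hμ.moment_typeII, smul_zero]
    rcases eq_or_ne k i with rfl | hki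
    · simp; omega
    · simp [hki]; omega

theorem moment_sum_typeII (hμ : IsAngelescoSystem μ) (a : Fin d → ℝ) {n : Fin d → ℕ}
    {k : Fin d} {l : ℕ} (hl : l + 1 = n k) :
    momentFunctional (μ k) ((∑ i, if n i = 0 then 0 else
      C (a i) * typeII μ (n - Pi.single i 1)) * X ^ l)
      = a k * typeIINorm μ (n - Pi.single k 1) k := by
  rw [Finset.sum_mul, map_sum, Finset.sum_eq_single k]
  · rw [if_neg (by omega), mul_assoc, ← smul_eq_C_mul, map_smul, smul_eq_mul, typeIINorm]
    congr 4
    simp; omega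
  · intro i _ hik
    split_ifs with hi
    · simp
    · rw [mul_assoc, ← smul_eq_C_mul, map_smul, hμ.moment_typeII, smul_zero]
      simp [hik.symm]; omega
  · simp

theorem coeff_sum_typeII_eq_zero (hμ : IsAngelescoSystem μ) (a : Fin d → ℝ) {n : Fin d → ℕ}
    {m : ℕ} (hm : multiSize n ≤ m) :
    (∑ i, if n i = 0 then 0 else C (a i) * typeII μ (n - Pi.single i 1)).coeff m = 0 := by
  rw [finsetSum_coeff]
  refine Finset.sum_eq_zero fun i _ => ?_
  split_ifs with hi
  · simp
  · have := multiSize_sub_single hi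
    rw [coeff_C_mul, hμ.coeff_typeII_eq_zero (by omega), mul_zero]

/-- The difference of the two sides has degree below `|n|`, because `subleadingDiff` matches the
coefficient of `x^{|n|}`. Its moments of order `l < n k` vanish: only `l = n k - 1` is in doubt,
where just the term of `P_{n-e_k}` survives and `normRatio` balances it. Normality concludes. -/
theorem typeII_recurrence (hμ : IsAngelescoSystem μ) (n : Fin d → ℕ) (j : Fin d) :
    X * typeII μ n = typeII μ (n + Pi.single j 1) + C (subleadingDiff μ n j) * typeII μ n
      + ∑ l, if n l = 0 then 0 else C (normRatio μ n l) * typeII μ (n - Pi.single l 1) := by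
  rw [← sub_eq_zero]
  refine hμ.eq_zero_of_degree_lt (n := n) ?_ fun k l hl => ?_
  · rw [degree_lt_iff_coeff_zero]
    intro m hm
    have hs := multiSize_add_single n j
    rw [coeff_sub, coeff_add, hμ.coeff_sum_typeII_eq_zero _ hm, add_zero, coeff_add, coeff_C_mul]
    rcases hm.eq_or_lt with rfl | hm
    · rw [hμ.coeff_typeII_multiSize, subleadingDiff, coeff_sub]; ring
    · rw [hμ.coeff_typeII_eq_zero hm, mul_zero, add_zero]
      obtain ⟨m, rfl⟩ : ∃ k, m = k + 1 := ⟨m - 1, by omega⟩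
      rw [coeff_X_mul]
      rcases (Nat.lt_succ_iff.1 hm).eq_or_lt with rfl | hm
      · rw [← hs, hμ.coeff_typeII_multiSize, hμ.coeff_typeII_multiSize, sub_self]
      · rw [hμ.coeff_typeII_eq_zero hm, hμ.coeff_typeII_eq_zero (by omega), sub_self]
  · have h1 : X * typeII μ n * X ^ l = typeII μ n * X ^ (l + 1) := by ring
    rw [sub_mul, add_mul, add_mul, map_sub, map_add, map_add, h1, mul_assoc (C _), ← smul_eq_C_mul,
      map_smul, hμ.moment_typeII hl, smul_zero, add_zero,
      hμ.moment_typeII (n := n + Pi.single j 1) (hl.trans_le (by simp)), zero_add]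
    rcases (Nat.succ_le_iff.2 hl).eq_or_lt with hl' | hl'
    · rw [hμ.moment_sum_typeII _ hl', normRatio, if_neg (by omega),
        div_mul_cancel₀ _ (hμ.typeIINorm_ne_zero _ _), typeIINorm, ← hl', sub_self]
    · rw [hμ.moment_sum_typeII_eq_zero _ hl', hμ.moment_typeII hl', sub_zero]

theorem recurrence_coeff_unique (hμ : IsAngelescoSystem μ) {n : Fin d → ℕ} {j : Fin d} {b : ℝ}
    {a : Fin d → ℝ}
    (h : X * typeII μ n = typeII μ (n + Pi.single j 1) + C b * typeII μ n
      + ∑ l, if n l = 0 then 0 else C (a l) * typeII μ (n - Pi.single l 1)) :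
    b = subleadingDiff μ n j ∧ ∀ l, n l ≠ 0 → a l = normRatio μ n l := by
  constructor
  · have := congrArg (fun p => p.coeff (multiSize n)) h
    simp only [coeff_add, hμ.coeff_sum_typeII_eq_zero _ le_rfl, coeff_C_mul,
      hμ.coeff_typeII_multiSize] at this
    rw [subleadingDiff, coeff_sub, this]; ring
  · intro k hk
    obtain ⟨l, hl⟩ : ∃ l, l + 1 = n k := ⟨n k - 1, by omega⟩
    have := congrArg (fun p => momentFunctional (μ k) (p * X ^ l)) h
    have h1 : X * typeII μ n * X ^ l = typeII μ n * X ^ (l + 1) := by ring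
    rw [add_mul, add_mul, map_add, map_add, h1, mul_assoc (C _), ← smul_eq_C_mul,
      map_smul, hμ.moment_typeII (n := n) (j := k) (l := l) (by omega), smul_zero, add_zero,
      hμ.moment_typeII (n := n + Pi.single j 1) (j := k) (l := l)
        ((show l < n k by omega).trans_le (by simp)), zero_add, hμ.moment_sum_typeII _ hl, hl] at this
    rw [normRatio, if_neg hk, eq_div_iff (hμ.typeIINorm_ne_zero _ _), ← this, typeIINorm]

/-! ### Recurrences of the type I forms -/

theorem formFunctional_typeI (hμ : IsAngelescoSystem μ) {n : Fin d → ℕ} {q : ℝ[X]}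
    (hq : q.degree < multiSize n) :
    formFunctional μ (typeI μ n) q = q.coeff (multiSize n - 1) := by
  have hA := hμ.isTypeI_typeI n
  have h := LinearMap.map_mul_eq_sum_coeff (formFunctional μ (typeI μ n)) 1 hq
  simp only [one_mul] at h
  rw [h]
  rcases Nat.eq_zero_or_pos (multiSize n) with h0 | h0
  · rw [h0, Finset.range_zero, Finset.sum_empty, coeff_eq_zero_of_degree_lt]
    rw [h0] at hq; exact hq
  · rw [Finset.sum_eq_single (multiSize n - 1), ← hμ.formMoment_eq, hA.normalized h0, mul_one]
    · intro l hl hne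
      have := Finset.mem_range.1 hl
      rw [← hμ.formMoment_eq, hA.orthogonal l (by omega), mul_zero]
    · intro h1
      exact absurd (Finset.mem_range.2 (by omega)) h1

theorem formFunctional_typeI_X_pow (hμ : IsAngelescoSystem μ) {n : Fin d → ℕ} {l : ℕ}
    (hl : l < multiSize n) :
    formFunctional μ (typeI μ n) (X ^ l) = if l + 1 = multiSize n then 1 else 0 := by
  rw [hμ.formFunctional_typeI (by rw [degree_X_pow]; exact_mod_cast hl), coeff_X_pow]
  congr 1
  simp only [eq_iff_iff]; omega

/-- The form `Q_n` annihilates `P_n`, so its first moment beyond the normalized one can be read off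
from the subleading coefficient of `P_n`. -/
theorem formFunctional_typeI_X_pow_multiSize (hμ : IsAngelescoSystem μ) {n : Fin d → ℕ}
    (h0 : 0 < multiSize n) :
    formFunctional μ (typeI μ n) (X ^ multiSize n) = -(typeII μ n).coeff (multiSize n - 1) := by
  have h1 : formFunctional μ (typeI μ n) (typeII μ n) = 0 := by
    rw [formFunctional_apply]
    refine Finset.sum_eq_zero fun j _ => ?_
    rw [mul_comm, hμ.moment_typeII_mul ((hμ.isTypeI_typeI n).degree_lt j)]
  have h2 := (hμ.typeII_monic n).degree_sub_X_pow_lt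
  rw [hμ.natDegree_typeII] at h2
  have h3 := hμ.formFunctional_typeI h2
  rw [map_sub, h1, coeff_sub, coeff_X_pow, if_neg (by omega), sub_zero, zero_sub] at h3
  rw [← h3, neg_neg]

/-- Evaluate `∫ P_n Q_{n+e_i}` twice: it is 1 because `P_n` is monic of degree `|n|`, and by
orthogonality only the top coefficient of the `i`-th component contributes. -/
theorem coeff_typeI_mul_typeIINorm (hμ : IsAngelescoSystem μ) (n : Fin d → ℕ) (i : Fin d) :
    (typeI μ (n + Pi.single i 1) i).coeff (n i) * typeIINorm μ n i = 1 := by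
  have hdeg : (typeII μ n).degree < (multiSize (n + Pi.single i 1) : WithBot ℕ) := by
    rw [degree_eq_natDegree (hμ.typeII_monic n).ne_zero, hμ.natDegree_typeII,
      multiSize_add_single]
    exact_mod_cast Nat.lt_succ_self _
  have h1 := hμ.formFunctional_typeI hdeg
  rw [multiSize_add_single, Nat.add_sub_cancel, hμ.coeff_typeII_multiSize,
    formFunctional_apply, Finset.sum_eq_single i] at h1
  · have hA := (hμ.isTypeI_typeI (n + Pi.single i 1)).degree_lt i
    rw [mul_comm, LinearMap.map_mul_eq_sum_coeff _ _ hA, Pi.add_apply, Pi.single_eq_same,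
      Finset.sum_range_succ, Finset.sum_eq_zero, zero_add] at h1
    · exact h1
    · intro l hl
      rw [hμ.moment_typeII (Finset.mem_range.1 hl), mul_zero]
  · intro k _ hki
    have hA := (hμ.isTypeI_typeI (n + Pi.single i 1)).degree_lt k
    rw [mul_comm, hμ.moment_typeII_mul]
    simpa [hki] using hA
  · simp

theorem coeff_typeI_eq_zero (hμ : IsAngelescoSystem μ) {n : Fin d → ℕ} {i : Fin d} {m : ℕ}
    (h : n i ≤ m) : (typeI μ n i).coeff m = 0 :=
  coeff_eq_zero_of_degree_lt
    (((hμ.isTypeI_typeI n).degree_lt i).trans_le (by exact_mod_cast h))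

/-- The difference of the two sides is a form of index `n`: the coefficients of degree `n i` cancel
since leading coefficients are inverse norms and `normRatio` is their quotient. Of its `|n|` moments
only the last two need work, and the last one gives the difference of subleading coefficients that
defines `b`. -/
theorem typeI_recurrence (hμ : IsAngelescoSystem μ) (hd : 2 ≤ d) {n : Fin d → ℕ}
    (hn : ∀ i, 1 ≤ n i) (j i : Fin d) :
    X * typeI μ n i = typeI μ (n - Pi.single j 1) i
      + C (subleadingDiff μ (n - Pi.single j 1) j) * typeI μ n i
      + ∑ l, C (normRatio μ n l) * typeI μ (n + Pi.single l 1) i := by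
  have hj : n j ≠ 0 := by have := hn j; omega
  set m := n - Pi.single j 1 with hm
  have hmn : m + Pi.single j 1 = n := sub_single_add_single hj
  have hsize : multiSize m + 1 = multiSize n := multiSize_sub_single hj
  have hdn := multiSize_of_forall_one_le hn
  have key : (fun i => X * typeI μ n i - typeI μ m i - C (subleadingDiff μ m j) * typeI μ n i
      - ∑ l, C (normRatio μ n l) * typeI μ (n + Pi.single l 1) i) = 0 := by
    refine hμ.form_eq_zero (n := n) (fun i => ?_) fun l hl => ?_
    · rw [degree_lt_iff_coeff_zero]
      intro k hk
      obtain ⟨k, rfl⟩ : ∃ p, k = p + 1 := ⟨k - 1, by have := hn i; omega⟩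
      have hmi : m i ≤ n i := by simp [hm]
      rw [coeff_sub, coeff_sub, coeff_sub, coeff_X_mul, hμ.coeff_typeI_eq_zero (hmi.trans hk),
        coeff_C_mul, hμ.coeff_typeI_eq_zero hk, finsetSum_coeff, Finset.sum_eq_single i]
      · rcases hk.eq_or_lt with hk | hk
        · have hi : n i ≠ 0 := by omega
          have h1 := hμ.coeff_typeI_mul_typeIINorm n i
          have h2 := hμ.coeff_typeI_mul_typeIINorm (n - Pi.single i 1) i
          rw [sub_single_add_single hi] at h2
          simp only [Pi.sub_apply, Pi.single_eq_same, hk, Nat.add_sub_cancel] at h2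
          have h3 := hμ.typeIINorm_ne_zero (n - Pi.single i 1) i
          have h4 := hμ.typeIINorm_ne_zero n i
          rw [coeff_C_mul, ← hk, normRatio, if_neg hi, eq_div_of_mul_eq h4 h1,
            eq_div_of_mul_eq h3 h2]
          field_simp
          ring
        · rw [hμ.coeff_typeI_eq_zero (n := n) (by omega), coeff_C_mul,
            hμ.coeff_typeI_eq_zero (n := n + Pi.single i 1) (by simp; omega)]
          ring
      · intro l _ hli
        rw [coeff_C_mul, hμ.coeff_typeI_eq_zero (n := n + Pi.single l 1), mul_zero]
        simpa [hli.symm] using hk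
      · simp
    · rw [formFunctional_sub, formFunctional_sub, formFunctional_sub, formFunctional_X_mul,
        formFunctional_C_mul, formFunctional_sum, Finset.sum_eq_zero, sub_zero, ← pow_succ',
        hμ.formFunctional_typeI_X_pow hl]
      · rcases (Nat.succ_le_iff.2 hl).eq_or_lt with hl' | hl'
        · have hlm : l = multiSize m := by omega
          have hb : subleadingDiff μ m j
              = (typeII μ m).coeff (multiSize m - 1) - (typeII μ n).coeff (multiSize n - 1) := by
            rw [subleadingDiff, hmn, coeff_sub, ← hsize, Nat.add_sub_cancel]
            congr 1
            obtain ⟨p, hp⟩ : ∃ p, multiSize m = p + 1 := ⟨multiSize m - 1, by omega⟩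
            rw [hp, coeff_X_mul, Nat.add_sub_cancel]
          rw [if_pos hl', show l + 1 = multiSize n from hl',
            hμ.formFunctional_typeI_X_pow_multiSize (by omega), hlm,
            hμ.formFunctional_typeI_X_pow_multiSize (by omega), hb]
          ring
        · rw [if_neg (by omega), hμ.formFunctional_typeI_X_pow hl',
            hμ.formFunctional_typeI_X_pow (by omega), mul_zero, sub_zero, sub_eq_zero]
          congr 1
          simp only [eq_iff_iff]; omega
      · intro k _
        have := multiSize_add_single n k
        rw [formFunctional_C_mul, hμ.formFunctional_typeI_X_pow (by omega), if_neg (by omega),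
          mul_zero]
  have h := congrFun key i
  simp only [Pi.zero_apply] at h
  linear_combination h

theorem isRecurrenceCoeff (hμ : IsAngelescoSystem μ) (hd : 2 ≤ d) :
    IsRecurrenceCoeff μ (normRatio μ, subleadingDiff μ) where
  a_eq_zero n j h := by simp [normRatio, h]
  typeII_rec := hμ.typeII_recurrence
  typeI_rec _ hn j i := hμ.typeI_recurrence hd hn j i

theorem existsUnique_recurrenceCoeff (hμ : IsAngelescoSystem μ) (hd : 2 ≤ d) :
    ∃! c, IsRecurrenceCoeff μ c := by
  refine ⟨_, hμ.isRecurrenceCoeff hd, fun c hc => Prod.ext ?_ ?_⟩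
  · funext n j
    by_cases hj : n j = 0
    · rw [hc.a_eq_zero n j hj]; simp [normRatio, hj]
    · exact (hμ.recurrence_coeff_unique (hc.typeII_rec n j)).2 j hj
  · funext n j
    exact (hμ.recurrence_coeff_unique (hc.typeII_rec n j)).1

theorem recCoeff_eq (hμ : IsAngelescoSystem μ) (hd : 2 ≤ d) :
    recCoeff μ = (normRatio μ, subleadingDiff μ) :=
  (hμ.existsUnique_recurrenceCoeff hd).unique
    (Classical.epsilon_spec (hμ.existsUnique_recurrenceCoeff hd).exists) (hμ.isRecurrenceCoeff hd)

theorem recA_eq (hμ : IsAngelescoSystem μ) (hd : 2 ≤ d) (n : Fin d → ℕ) (j : Fin d) :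
    recA μ n j = normRatio μ n j := by rw [recA, hμ.recCoeff_eq hd]

theorem recB_eq (hμ : IsAngelescoSystem μ) (hd : 2 ≤ d) (n : Fin d → ℕ) (j : Fin d) :
    recB μ n j = subleadingDiff μ n j := by rw [recB, hμ.recCoeff_eq hd]

theorem treeW_pos (hμ : IsAngelescoSystem μ) (hd : 2 ≤ d) (Y : TreeVertex d) :
    0 < treeW μ Y := by
  cases Y with
  | nil => exact one_pos
  | cons l Y =>
    rw [treeW, hμ.recA_eq hd]
    exact hμ.normRatio_pos (by have := treeProj_pos Y l; omega)

end IsAngelescoSystem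

/-! ### Interlacing and bounds of the recurrence coefficients -/

namespace IsAngelescoSystem

variable {d : ℕ} {μ : Fin d → Measure ℝ}

/-- No nontrivial combination of neighbouring type II polynomials has a double zero. -/
theorem combination_no_double_root (hμ : IsAngelescoSystem μ) (n : Fin d → ℕ) (j : Fin d)
    {α β x : ℝ} (h0 : α ≠ 0 ∨ β ≠ 0)
    (h1 : (C α * typeII μ n + C β * typeII μ (n + Pi.single j 1)).eval x = 0)
    (h2 : (derivative (C α * typeII μ n + C β * typeII μ (n + Pi.single j 1))).eval x = 0) :
    False := by
  have hs := multiSize_add_single n j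
  set f := C α * typeII μ n + C β * typeII μ (n + Pi.single j 1) with hf
  have hf0 : f ≠ 0 := by
    intro hz
    have hβ : β = 0 := by
      have := congrArg (fun p => p.coeff (multiSize (n + Pi.single j 1))) hz
      simpa [hf, hμ.coeff_typeII_eq_zero (n := n) (m := multiSize (n + Pi.single j 1)) (by omega),
        hμ.coeff_typeII_multiSize] using this
    have hα : α = 0 := by
      have := congrArg (fun p => p.coeff (multiSize n)) hz
      simpa [hf, hβ, hμ.coeff_typeII_multiSize] using this
    exact h0.elim (· hα) (· hβ)
  have hdvd : (X - C x) ^ 2 ∣ f :=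
    (le_rootMultiplicity_iff hf0).1 ((one_lt_rootMultiplicity_iff_isRoot hf0).2 ⟨h1, h2⟩)
  obtain ⟨g, hg⟩ := hdvd
  have hfdeg : f.natDegree ≤ multiSize n + 1 := by
    refine natDegree_add_le_of_degree_le ((natDegree_C_mul_le _ _).trans ?_)
      ((natDegree_C_mul_le _ _).trans ?_)
    · rw [hμ.natDegree_typeII]; omega
    · rw [hμ.natDegree_typeII, hs]
  have hg0 : g ≠ 0 := by rintro rfl; exact hf0 (by rw [hg, mul_zero])
  have hw : (X - C x) ^ 2 ≠ (0 : ℝ[X]) := pow_ne_zero 2 (X_sub_C_ne_zero x)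
  -- The cofactor of the double zero has degree below `|n|` and is orthogonal with the nonnegative
  -- weight `(X - C x) ^ 2`.
  refine hg0 (hμ.eq_zero_of_orthogonal (n := n) hw
    (fun y => by simpa using sq_nonneg (y - x)) ?_ fun k l hl => ?_)
  · rw [hg, natDegree_mul hw hg0, natDegree_pow, natDegree_X_sub_C] at hfdeg
    rw [degree_eq_natDegree hg0]
    exact_mod_cast (by omega : g.natDegree < multiSize n)
  · rw [mul_comm g, ← hg, hf, add_mul, mul_assoc, mul_assoc, map_add, ← smul_eq_C_mul,
      ← smul_eq_C_mul, map_smul, map_smul, hμ.moment_typeII hl,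
      hμ.moment_typeII (hl.trans_le (by simp)), smul_zero, smul_zero, add_zero]

/-- The Wronskian of neighbouring type II polynomials has no real zeros. -/
theorem wronskian_ne_zero (hμ : IsAngelescoSystem μ) (n : Fin d → ℕ) (j : Fin d) (x : ℝ) :
    (typeII μ n * derivative (typeII μ (n + Pi.single j 1))
      - derivative (typeII μ n) * typeII μ (n + Pi.single j 1)).eval x ≠ 0 := by
  intro hW
  simp only [eval_sub, eval_mul] at hW
  have key := fun α β => hμ.combination_no_double_root n j (α := α) (β := β) (x := x)
  simp only [derivative_add, derivative_C_mul, eval_add, eval_mul, eval_C] at key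
  set p := (typeII μ n).eval x
  set q := (typeII μ (n + Pi.single j 1)).eval x
  set p' := (derivative (typeII μ n)).eval x
  set q' := (derivative (typeII μ (n + Pi.single j 1))).eval x
  -- A singular 2 × 2 matrix of values and derivatives has a kernel vector: `(q, -p)`, else `(q',
  -- -p')`, else any vector. The corresponding combination has a double zero at `x`.
  by_cases hq : q ≠ 0 ∨ -p ≠ 0
  · exact key q (-p) hq (by ring) (by linear_combination -hW)
  push Not at hq
  obtain ⟨hq, hp⟩ := hq
  rw [neg_eq_zero] at hp
  by_cases hq' : q' ≠ 0 ∨ -p' ≠ 0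
  · exact key q' (-p') hq' (by rw [hp, hq]; ring) (by ring)
  push Not at hq'
  obtain ⟨hq', hp'⟩ := hq'
  rw [neg_eq_zero] at hp'
  exact key 1 0 (Or.inl one_ne_zero) (by rw [hp]; ring) (by rw [hp']; ring)

theorem exists_nodal (hμ : IsAngelescoSystem μ) (n : Fin d → ℕ) :
    ∃ T : Finset ℝ, (∀ s ∈ T, ∃ j, s ∈ convexHull ℝ (μ j).support) ∧ T.card = multiSize n ∧
      typeII μ n = Lagrange.nodal T id := by
  obtain ⟨S, hS, hcard, hdisj, hP⟩ := hμ.typeII_eq_prod_nodal n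
  refine ⟨Finset.univ.biUnion S, fun s hs => ?_, ?_, ?_⟩
  · obtain ⟨j, -, hj⟩ := Finset.mem_biUnion.1 hs
    exact ⟨j, hS j s hj⟩
  · rw [Finset.card_biUnion fun i _ j _ hij => hdisj hij]
    exact Finset.sum_congr rfl fun j _ => hcard j
  · simp only [hP, Lagrange.nodal_eq]
    rw [Finset.prod_biUnion fun i _ j _ hij => hdisj hij]

/-- The partial fraction expansion of `P_n / P_{n+eⱼ}` has positive residues; the residues
integrate polynomials modulo `P_{n+eⱼ}` against `P_n`. -/
theorem exists_residues (hμ : IsAngelescoSystem μ) (n : Fin d → ℕ) (j : Fin d) :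
    ∃ (T : Finset ℝ) (c : ℝ → ℝ), (∀ s ∈ T, ∃ j, s ∈ convexHull ℝ (μ j).support) ∧
      (∀ s ∈ T, 0 < c s) ∧ ∀ f : ℝ[X], ∀ g : ℝ[X], f.degree < (multiSize n + 1 : ℕ) →
        (∃ h, f = g * typeII μ n - h * typeII μ (n + Pi.single j 1)) →
        f.coeff (multiSize n) = ∑ s ∈ T, c s * g.eval s := by
  obtain ⟨T, hT, hcard, hQ⟩ := hμ.exists_nodal (n + Pi.single j 1)
  rw [multiSize_add_single] at hcard
  -- The residue `P_n(s) / P_{n+e_j}'(s)`; Lagrange interpolation at the zeros of `P_{n+e_j}` gives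
  -- the quadrature formula.
  set c : ℝ → ℝ := fun s => (typeII μ n).eval s / ∏ t ∈ T.erase s, (s - t) with hc
  have hsum : ∀ f : ℝ[X], ∀ g : ℝ[X], f.degree < (multiSize n + 1 : ℕ) →
        (∃ h, f = g * typeII μ n - h * typeII μ (n + Pi.single j 1)) →
        f.coeff (multiSize n) = ∑ s ∈ T, c s * g.eval s := by
    rintro f g hf ⟨h, hfg⟩
    rw [← hcard] at hf
    have := Lagrange.coeff_eq_sum (s := T) (v := (id : ℝ → ℝ)) (Set.injOn_id _) hf
    rw [hcard, Nat.add_sub_cancel] at this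
    rw [this]
    refine Finset.sum_congr rfl fun s hs => ?_
    have h0 : (Lagrange.nodal T (id : ℝ → ℝ)).eval s = 0 := Lagrange.eval_nodal_at_node (v := id) hs
    simp only [id, hfg, eval_sub, eval_mul, hQ, h0, hc]
    ring
  refine ⟨T, c, hT, ?_, hsum⟩
  set W := typeII μ n * derivative (typeII μ (n + Pi.single j 1))
      - derivative (typeII μ n) * typeII μ (n + Pi.single j 1) with hW
  have hcW : ∀ s ∈ T, (∏ t ∈ T.erase s, (s - t)) ^ 2 * c s = W.eval s := by
    intro s hs
    have h0 : (Lagrange.nodal T (id : ℝ → ℝ)).eval s = 0 := Lagrange.eval_nodal_at_node (v := id) hs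
    have h1 : (derivative (Lagrange.nodal T (id : ℝ → ℝ))).eval s = ∏ t ∈ T.erase s, (s - t) := by
      have := Lagrange.eval_nodal_derivative_eval_node_eq (v := (id : ℝ → ℝ)) hs
      rw [Lagrange.eval_nodal] at this
      exact this
    have hne : ∏ t ∈ T.erase s, (s - t) ≠ 0 := by
      rw [Finset.prod_ne_zero_iff]
      exact fun t ht => sub_ne_zero.2 (Finset.ne_of_mem_erase ht).symm
    rw [hW, eval_sub, eval_mul, eval_mul, hQ, h0, h1, hc]
    field_simp
    ring
  -- Each residue has the sign of the Wronskian, which is constant on the line; since the sum is 1,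
  -- that sign is positive.
  have hone : ∑ s ∈ T, c s = 1 := by
    have := hsum (typeII μ n) 1 ?_ ⟨0, by ring⟩
    · rw [hμ.coeff_typeII_multiSize] at this
      simpa using this.symm
    · rw [degree_eq_natDegree (hμ.typeII_monic n).ne_zero, hμ.natDegree_typeII]
      exact_mod_cast Nat.lt_succ_self _
  obtain ⟨t, ht, htpos⟩ : ∃ t ∈ T, 0 < c t := by
    by_contra! hcon
    have := Finset.sum_nonpos hcon
    linarith
  have hWt : 0 ≤ W.eval t := by
    rw [← hcW t ht]; positivity
  intro s hs
  have hWs : 0 < W.eval s := by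
    by_contra! hneg
    obtain ⟨y, -, hy⟩ := isPreconnected_univ.intermediate_value (Set.mem_univ s) (Set.mem_univ t)
      W.continuous.continuousOn ⟨hneg, hWt⟩
    exact hμ.wronskian_ne_zero n j y hy
  rw [← hcW s hs] at hWs
  exact pos_of_mul_pos_right hWs (sq_nonneg _)

theorem exists_hull_bound (hμ : IsAngelescoSystem μ) :
    ∃ M : ℝ, 0 ≤ M ∧ ∀ j, ∀ x ∈ convexHull ℝ (μ j).support, |x| ≤ M := by
  have : ∀ j, ∃ M : ℝ, ∀ x ∈ convexHull ℝ (μ j).support, |x| ≤ M := fun j => by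
    obtain ⟨M, hM⟩ := (isBounded_convexHull.2 (hμ.compact_support j).isBounded).exists_norm_le
    exact ⟨M, hM⟩
  choose M hM using this
  refine ⟨∑ j, |M j|, Finset.sum_nonneg fun j _ => abs_nonneg _, fun j x hx => ?_⟩
  exact (hM j x hx).trans ((le_abs_self _).trans
    (Finset.single_le_sum (f := fun j => |M j|) (fun _ _ => abs_nonneg _) (Finset.mem_univ j)))

/-- The residues form a probability measure on points of modulus at most `M`. Testing with 1, `X`
and `X ^ 2` modulo `P_{n+e_j}` gives total mass 1, mean `b` and second moment `b ^ 2 + ∑ a`; as all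
`a` are nonnegative, each is at most `M ^ 2`. -/
theorem recurrence_coeff_le (hμ : IsAngelescoSystem μ) {M : ℝ}
    (hM : ∀ j, ∀ x ∈ convexHull ℝ (μ j).support, |x| ≤ M) (n : Fin d → ℕ) (j : Fin d) :
    |subleadingDiff μ n j| ≤ M ∧ ∀ l, normRatio μ n l ≤ M ^ 2 := by
  obtain ⟨T, c, hT, hc, hsum⟩ := hμ.exists_residues n j
  have hTM : ∀ s ∈ T, |s| ≤ M := fun s hs => (hT s hs).elim fun j hj => hM j s hj
  set b := subleadingDiff μ n j with hb
  set R := ∑ l, if n l = 0 then 0 else C (normRatio μ n l) * typeII μ (n - Pi.single l 1) with hR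
  have hrec : X * typeII μ n = typeII μ (n + Pi.single j 1) + C b * typeII μ n + R :=
    hμ.typeII_recurrence n j
  have hRcoeff : ∀ m, multiSize n ≤ m → R.coeff m = 0 := fun m hm =>
    hμ.coeff_sum_typeII_eq_zero _ hm
  have hPdeg : (typeII μ n).degree < (multiSize n + 1 : ℕ) := by
    rw [degree_eq_natDegree (hμ.typeII_monic n).ne_zero, hμ.natDegree_typeII]
    exact_mod_cast Nat.lt_succ_self _
  have hfdeg : (C b * typeII μ n + R).degree < (multiSize n + 1 : ℕ) := by
    rw [degree_lt_iff_coeff_zero]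
    intro m hm
    rw [coeff_add, coeff_C_mul, hμ.coeff_typeII_eq_zero (by omega), hRcoeff m (by omega)]
    ring
  have h0 : ∑ s ∈ T, c s = 1 := by
    have := hsum (typeII μ n) 1 hPdeg ⟨0, by ring⟩
    rw [hμ.coeff_typeII_multiSize] at this
    simpa using this.symm
  have h1 : b = ∑ s ∈ T, c s * s := by
    have := hsum (C b * typeII μ n + R) X hfdeg ⟨1, by rw [hrec]; ring⟩
    rw [coeff_add, coeff_C_mul, hRcoeff _ le_rfl, hμ.coeff_typeII_multiSize] at this
    simpa using this
  have hbM : |b| ≤ M := by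
    rw [h1]
    refine (Finset.abs_sum_le_sum_abs _ _).trans ?_
    calc ∑ s ∈ T, |c s * s| ≤ ∑ s ∈ T, c s * M := Finset.sum_le_sum fun s hs => by
          rw [abs_mul, abs_of_pos (hc s hs)]
          exact mul_le_mul_of_nonneg_left (hTM s hs) (hc s hs).le
      _ = M := by rw [← Finset.sum_mul, h0, one_mul]
  refine ⟨hbM, fun l => ?_⟩
  by_cases hl : n l = 0
  · rw [normRatio, if_pos hl]; positivity
  obtain ⟨p, hp⟩ : ∃ p, multiSize n = p + 1 :=
    ⟨multiSize n - 1, by have := le_multiSize n l; omega⟩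
  have h2 : b ^ 2 + R.coeff p = ∑ s ∈ T, c s * s ^ 2 := by
    have := hsum (C b * (C b * typeII μ n + R) + X * R) (X ^ 2) ?_
      ⟨C b + X, by linear_combination (-C b - X) * hrec⟩
    · rw [coeff_add, coeff_C_mul, coeff_add, coeff_C_mul, hRcoeff _ le_rfl,
        hμ.coeff_typeII_multiSize, hp, coeff_X_mul] at this
      simp only [eval_pow, eval_X] at this
      rw [← this]; ring
    · rw [degree_lt_iff_coeff_zero] at hfdeg ⊢
      intro m hm
      rw [coeff_add, coeff_C_mul, hfdeg m hm, mul_zero, zero_add]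
      obtain ⟨k, rfl⟩ : ∃ k, m = k + 1 := ⟨m - 1, by omega⟩
      rw [coeff_X_mul, hRcoeff k (by omega)]
  have h3 : R.coeff p = ∑ i, normRatio μ n i := by
    rw [hR, finsetSum_coeff]
    refine Finset.sum_congr rfl fun i _ => ?_
    split_ifs with hi
    · simp [normRatio, hi]
    · have hsz : multiSize (n - Pi.single i 1) = p := by
        have := multiSize_sub_single hi; omega
      rw [coeff_C_mul, ← hsz, hμ.coeff_typeII_multiSize, mul_one]
  have h4 : ∑ s ∈ T, c s * s ^ 2 ≤ M ^ 2 := by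
    calc ∑ s ∈ T, c s * s ^ 2 ≤ ∑ s ∈ T, c s * M ^ 2 := Finset.sum_le_sum fun s hs =>
          mul_le_mul_of_nonneg_left (sq_le_sq.2 ((hTM s hs).trans (le_abs_self M))) (hc s hs).le
      _ = M ^ 2 := by rw [← Finset.sum_mul, h0, one_mul]
  have h5 : normRatio μ n l ≤ ∑ i, normRatio μ n i :=
    Finset.single_le_sum (f := fun i => normRatio μ n i) (fun i _ => by
      by_cases hi : n i = 0
      · simp [normRatio, hi]
      · exact (hμ.normRatio_pos hi).le) (Finset.mem_univ l)
  nlinarith [sq_nonneg b]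

end IsAngelescoSystem

/-! ### The Jacobi operator on the tree -/

/-- A weighted composition operator with bounded weight and uniformly finite fibres is bounded. -/
theorem exists_weightedComp {ι : Type*} (φ : ι → ι) (N : ℕ)
    (hφ : ∀ (t : Finset ι) (y : ι), (∀ i ∈ t, φ i = y) → t.card ≤ N)
    (w : ι → ℂ) {C : ℝ} (hw : ∀ i, ‖w i‖ ≤ C) :
    ∃ T : lp (fun _ : ι => ℂ) 2 →L[ℂ] lp (fun _ : ι => ℂ) 2, ∀ f i, T f i = w i * f (φ i) := by
  classical
  have hbound : ∀ (f : lp (fun _ : ι => ℂ) 2) (s : Finset ι),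
      ∑ i ∈ s, ‖w i * f (φ i)‖ ^ (2 : ENNReal).toReal ≤ C ^ 2 * (N * ‖f‖ ^ 2) := by
    intro f s
    have h2 : (0 : ℝ) < (2 : ENNReal).toReal := by norm_num
    have hsum := fun t => lp.sum_rpow_le_norm_rpow h2 f t
    simp only [ENNReal.toReal_ofNat, Real.rpow_ofNat] at hsum ⊢
    calc ∑ i ∈ s, ‖w i * f (φ i)‖ ^ 2 ≤ ∑ i ∈ s, C ^ 2 * ‖f (φ i)‖ ^ 2 :=
          Finset.sum_le_sum fun i _ => by
            rw [norm_mul, mul_pow]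
            gcongr
            exact hw i
      _ = C ^ 2 * ∑ y ∈ s.image φ, (s.filter fun i => φ i = y).card • ‖f y‖ ^ 2 := by
          rw [← Finset.mul_sum, Finset.sum_comp (fun y => ‖f y‖ ^ 2) φ]
      _ ≤ C ^ 2 * ∑ y ∈ s.image φ, N * ‖f y‖ ^ 2 := by
          gcongr with y hy
          rw [nsmul_eq_mul]
          gcongr
          exact hφ _ y fun i hi => (Finset.mem_filter.1 hi).2
      _ ≤ C ^ 2 * (N * ‖f‖ ^ 2) := by
          rw [← Finset.mul_sum]
          gcongr
          exact hsum _
  let T : lp (fun _ : ι => ℂ) 2 →ₗ[ℂ] lp (fun _ : ι => ℂ) 2 :=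
    { toFun := fun f => ⟨fun i => w i * f (φ i), memℓp_gen' (hbound f)⟩
      map_add' := fun f g => by
        ext i
        simp [mul_add]
        rfl
      map_smul' := fun c f => by
        ext i
        simp only [lp.coeFn_smul, Pi.smul_apply, smul_eq_mul, RingHom.id_apply]
        ring }
  refine ⟨T.mkContinuous (Real.sqrt (C ^ 2 * N)) fun f => ?_, fun f i => rfl⟩
  refine lp.norm_le_of_forall_sum_le (by norm_num) (by positivity) fun s => ?_
  refine (hbound f s).trans (le_of_eq ?_)
  simp only [ENNReal.toReal_ofNat, Real.rpow_ofNat]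
  rw [mul_pow, Real.sq_sqrt (by positivity), mul_assoc]

theorem treeDelta_apply {d : ℕ} (X Y : TreeVertex d) :
    treeDelta X Y = if Y = X then 1 else 0 := by
  rw [treeDelta, lp.coeFn_single, Pi.single_apply]

theorem inner_treeDelta {d : ℕ} (X : TreeVertex d) (f : TreeL2 d) :
    inner ℂ (treeDelta X) f = f X := by
  rw [treeDelta, lp.inner_single_left]
  simp

/-- The weighted creation operator together with its adjoint. -/
theorem exists_shift {d : ℕ} (w : TreeVertex d → ℝ) (h0 : w [] = 0) {C : ℝ}
    (hw : ∀ Y, |w Y| ≤ C) : ∃ B : TreeL2 d →L[ℂ] TreeL2 d,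
      (∀ f Y, B f Y = (w Y : ℂ) * f Y.tail) ∧
      ∀ f Y, B.adjoint f Y = ∑ i : Fin d, (w (i :: Y) : ℂ) * f (i :: Y) := by
  -- The fibre of `List.tail` over a vertex consists of its `d` children; over the root it also
  -- contains the root itself, whence `d + 1`.
  obtain ⟨B, hB⟩ := exists_weightedComp (ι := TreeVertex d) List.tail (d + 1)
    (fun t y ht => by
      have hsub : t ⊆ insert [] (Finset.univ.image fun i : Fin d => i :: y) := by
        intro X hX
        have := ht X hX
        cases X with
        | nil => simp
        | cons l Z => simp at this; simp [this]
      refine (Finset.card_le_card hsub).trans ((Finset.card_insert_le _ _).trans ?_)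
      exact Nat.succ_le_succ (Finset.card_image_le.trans (by simp)))
    (fun Y => (w Y : ℂ)) (C := C) (fun Y => by simpa using hw Y)
  refine ⟨B, hB, fun f Y => ?_⟩
  have hBe : B (treeDelta Y) = ∑ i : Fin d, (w (i :: Y) : ℂ) • treeDelta (i :: Y) := by
    ext X
    rw [hB, lp.coeFn_sum, Finset.sum_apply]
    simp only [lp.coeFn_smul, Pi.smul_apply, treeDelta_apply, smul_eq_mul]
    cases X with
    | nil => simp [h0]
    | cons l Z =>
      by_cases hZ : Z = Y
      · subst hZ; simp
      · simp [hZ]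
  rw [← inner_treeDelta, ContinuousLinearMap.adjoint_inner_right, hBe, sum_inner]
  refine Finset.sum_congr rfl fun i _ => ?_
  rw [inner_smul_left, inner_treeDelta, Complex.conj_ofReal]

theorem exists_diagonal {ι : Type*} (v : ι → ℝ) {C : ℝ} (hv : ∀ i, |v i| ≤ C) :
    ∃ D : lp (fun _ : ι => ℂ) 2 →L[ℂ] lp (fun _ : ι => ℂ) 2, IsSelfAdjoint D ∧
      ∀ f i, D f i = (v i : ℂ) * f i := by
  classical
  obtain ⟨D, hD⟩ := exists_weightedComp (ι := ι) id 1
    (fun t y ht => Finset.card_le_one.2 fun a ha b hb => (ht a ha).trans (ht b hb).symm)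
    (fun i => (v i : ℂ)) (C := C) (fun i => by simpa using hv i)
  refine ⟨D, ?_, hD⟩
  rw [ContinuousLinearMap.isSelfAdjoint_iff_isSymmetric]
  intro f g
  simp only [ContinuousLinearMap.coe_coe, lp.inner_eq_tsum]
  refine tsum_congr fun i => ?_
  rw [hD, hD]
  simp only [id, RCLike.inner_apply, map_mul, Complex.conj_ofReal]
  ring

namespace IsAngelescoSystem

variable {d : ℕ} {μ : Fin d → Measure ℝ}

theorem exists_jacobi (hμ : IsAngelescoSystem μ) (hd : 2 ≤ d) (κ : Fin d → ℝ) :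
    ∃ J : TreeL2 d →L[ℂ] TreeL2 d, IsSelfAdjoint J ∧
      ∀ (f : TreeL2 d) (Y : TreeVertex d), J f Y = jacobiAction μ κ (fun X => f X) Y := by
  obtain ⟨M, hM0, hM⟩ := hμ.exists_hull_bound
  have hV : ∀ Y, |treeV μ κ Y| ≤ |treeV μ κ []| + M := by
    intro Y
    cases Y with
    | nil => linarith
    | cons l Y =>
      have : |treeV μ κ (l :: Y)| ≤ M := by
        rw [treeV, hμ.recB_eq hd]; exact (hμ.recurrence_coeff_le hM _ _).1
      linarith [abs_nonneg (treeV μ κ [])]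
  -- The weight at the root must be 0 here and not `treeW μ [] = 1`: the tail of the root is the
  -- root, which would produce a spurious loop.
  let w : TreeVertex d → ℝ := fun Y => match Y with
    | [] => 0
    | l :: Y => Real.sqrt (treeW μ (l :: Y))
  have hw : ∀ Y, |w Y| ≤ M := by
    intro Y
    cases Y with
    | nil => simpa [w] using hM0
    | cons l Y =>
      simp only [w]
      rw [abs_of_nonneg (Real.sqrt_nonneg _), treeW, hμ.recA_eq hd]
      exact Real.sqrt_le_iff.2 ⟨hM0, (hμ.recurrence_coeff_le hM _ l).2 l⟩
  obtain ⟨D, hDs, hD⟩ := exists_diagonal (treeV μ κ) hV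
  obtain ⟨B, hB, hB'⟩ := exists_shift w rfl hw
  refine ⟨D + (B + star B), hDs.add (IsSelfAdjoint.add_star_self B), fun f Y => ?_⟩
  have : (D + (B + star B)) f Y = D f Y + (B f Y + B.adjoint f Y) := rfl
  rw [this, hD, hB, hB']
  cases Y with
  | nil => simp [jacobiAction, w]
  | cons l Y => simp only [jacobiAction, w, List.tail_cons]; ring

end IsAngelescoSystem

/-! ### Cauchy transforms -/

/-- The functional `p ↦ ∫ p(x) / (z - x) dμ(x)`. -/
def cauchyFunctional (μ : Measure ℝ) (z : ℂ) : ℝ[X] →ₗ[ℝ] ℂ :=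
  Polynomial.lsum fun n =>
    LinearMap.toSpanSingleton ℝ ℂ (∫ x, ((x ^ n : ℝ) : ℂ) / (z - (x : ℂ)) ∂μ)

section Cauchy

variable {μ : Measure ℝ} {z : ℂ}

theorem continuousOn_div_sub (hz : z ∉ (fun x : ℝ => (x : ℂ)) '' μ.support) {f : ℝ → ℝ}
    (hf : Continuous f) : ContinuousOn (fun x : ℝ => (f x : ℂ) / (z - (x : ℂ))) μ.support := by
  refine ContinuousOn.div (by fun_prop) (by fun_prop) fun x hx h0 => hz ⟨x, hx, ?_⟩
  exact (sub_eq_zero.1 h0).symm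

theorem cauchyFunctional_apply [IsFiniteMeasure μ] (hc : IsCompact μ.support)
    (hz : z ∉ (fun x : ℝ => (x : ℂ)) '' μ.support) (p : ℝ[X]) :
    cauchyFunctional μ z p = ∫ x, ((p.eval x : ℝ) : ℂ) / (z - (x : ℂ)) ∂μ := by
  simp only [cauchyFunctional, Polynomial.lsum_apply, Polynomial.sum_def,
    LinearMap.toSpanSingleton_apply, Polynomial.eval_eq_sum, Complex.ofReal_sum, Finset.sum_div]
  rw [integral_finsetSum]
  · refine Finset.sum_congr rfl fun i _ => ?_
    rw [Complex.real_smul, ← integral_const_mul]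
    congr 1; ext x
    rw [Complex.ofReal_mul, mul_div_assoc]
  · intro i _
    exact integrable_of_continuousOn_support hc (continuousOn_div_sub hz (by fun_prop))

/-- Write `x = z - (z - x)` in the numerator. -/
theorem cauchyFunctional_X_mul [IsFiniteMeasure μ] (hc : IsCompact μ.support)
    (hz : z ∉ (fun x : ℝ => (x : ℂ)) '' μ.support) (p : ℝ[X]) :
    cauchyFunctional μ z (X * p) = z * cauchyFunctional μ z p - (momentFunctional μ p : ℂ) := by
  rw [cauchyFunctional_apply hc hz, cauchyFunctional_apply hc hz, momentFunctional_apply hc,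
    ← integral_const_mul, ← integral_complex_ofReal, ← integral_sub]
  · refine integral_congr_ae ?_
    filter_upwards [Measure.support_mem_ae] with x hx
    have : z - (x : ℂ) ≠ 0 := fun h0 => hz ⟨x, hx, (sub_eq_zero.1 h0).symm⟩
    simp only [eval_mul, eval_X, Complex.ofReal_mul]
    field_simp
    ring
  · exact (integrable_of_continuousOn_support hc
      (continuousOn_div_sub hz p.continuous)).const_mul z
  · exact integrable_of_continuousOn_support hc (by fun_prop)

theorem norm_integral_pow_mul_le [IsFiniteMeasure μ] (hc : IsCompact μ.support) {f : ℝ → ℂ}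
    (hf : ContinuousOn f μ.support) {R : ℝ} (hR : ∀ x ∈ μ.support, |x| ≤ R) :
    ∃ C : ℝ, ∀ k : ℕ, ‖∫ x, ((x ^ k : ℝ) : ℂ) * f x ∂μ‖ ≤ C * R ^ k := by
  obtain ⟨B, hB⟩ := hc.exists_bound_of_continuousOn hf
  refine ⟨B * μ.real Set.univ, fun k => ?_⟩
  have h := norm_integral_le_of_norm_le_const (μ := μ) (C := R ^ k * B)
    (f := fun x : ℝ => ((x ^ k : ℝ) : ℂ) * f x) ?_
  · exact h.trans (le_of_eq (by ring))
  · filter_upwards [Measure.support_mem_ae] with x hx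
    rw [norm_mul, Complex.norm_real, norm_pow, Real.norm_eq_abs]
    exact mul_le_mul (pow_le_pow_left₀ (abs_nonneg x) (hR x hx) k) (hB x hx) (norm_nonneg _)
      (pow_nonneg ((abs_nonneg x).trans (hR x hx)) k)

theorem norm_momentFunctional_le [IsFiniteMeasure μ] (hc : IsCompact μ.support) {R : ℝ}
    (hR : ∀ x ∈ μ.support, |x| ≤ R) (p : ℝ[X]) :
    ∃ C : ℝ, ∀ k : ℕ, |momentFunctional μ (p * X ^ k)| ≤ C * R ^ k := by
  obtain ⟨C, hC⟩ := norm_integral_pow_mul_le hc (f := fun x => ((p.eval x : ℝ) : ℂ))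
    (by fun_prop) hR
  refine ⟨C, fun k => (le_of_eq ?_).trans (hC k)⟩
  rw [momentFunctional_apply hc, ← Real.norm_eq_abs, ← Complex.norm_real,
    ← integral_complex_ofReal]
  congr 2; ext x
  simp [mul_comm]

theorem norm_cauchyFunctional_le [IsFiniteMeasure μ] (hc : IsCompact μ.support)
    (hz : z ∉ (fun x : ℝ => (x : ℂ)) '' μ.support) {R : ℝ}
    (hR : ∀ x ∈ μ.support, |x| ≤ R) (p : ℝ[X]) :
    ∃ C : ℝ, ∀ k : ℕ, ‖cauchyFunctional μ z (X ^ k * p)‖ ≤ C * R ^ k := by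
  obtain ⟨C, hC⟩ := norm_integral_pow_mul_le hc (continuousOn_div_sub hz p.continuous) hR
  refine ⟨C, fun k => (le_of_eq ?_).trans (hC k)⟩
  rw [cauchyFunctional_apply hc hz]
  congr 2; ext x
  simp [mul_div_assoc]

theorem cauchyFunctional_eq_sum_add [IsFiniteMeasure μ] (hc : IsCompact μ.support)
    (hz : z ∉ (fun x : ℝ => (x : ℂ)) '' μ.support) (h0 : z ≠ 0) (p : ℝ[X]) (K : ℕ) :
    cauchyFunctional μ z p = ∑ k ∈ Finset.range K,
      z⁻¹ ^ (k + 1) * (momentFunctional μ (p * X ^ k) : ℂ)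
        + z⁻¹ ^ K * cauchyFunctional μ z (X ^ K * p) := by
  induction K with
  | zero => simp
  | succ K ih =>
    rw [Finset.sum_range_succ, ih, pow_succ' X, mul_assoc X, cauchyFunctional_X_mul hc hz,
      mul_comm (X ^ K) p]
    linear_combination
      (-(z⁻¹ ^ K * cauchyFunctional μ z (p * X ^ K))) * (mul_inv_cancel₀ h0)

/-- The Laurent expansion of the Cauchy transform at infinity. -/
theorem tendsto_cauchyFunctional [IsFiniteMeasure μ] (hc : IsCompact μ.support) {R : ℝ}
    (hR : ∀ x ∈ μ.support, |x| ≤ R) (hR0 : 0 ≤ R) (hzR : R < ‖z‖) (p : ℝ[X]) :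
    Filter.Tendsto (fun K => ∑ k ∈ Finset.range K,
      z⁻¹ ^ (k + 1) * (momentFunctional μ (p * X ^ k) : ℂ)) Filter.atTop
      (nhds (cauchyFunctional μ z p)) := by
  have h0 : z ≠ 0 := by rintro rfl; rw [norm_zero] at hzR; linarith
  have hz : z ∉ (fun x : ℝ => (x : ℂ)) '' μ.support := by
    rintro ⟨x, hx, rfl⟩
    simp only [Complex.norm_real, Real.norm_eq_abs] at hzR
    exact absurd (hR x hx) (not_le.2 hzR)
  obtain ⟨C, hC⟩ := norm_cauchyFunctional_le hc hz hR p
  have hrem : Filter.Tendsto (fun K => z⁻¹ ^ K * cauchyFunctional μ z (X ^ K * p))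
      Filter.atTop (nhds 0) := by
    have hlim : Filter.Tendsto (fun K : ℕ => C * (R / ‖z‖) ^ K) Filter.atTop (nhds 0) := by
      have := (tendsto_pow_atTop_nhds_zero_of_lt_one (r := R / ‖z‖) (by positivity)
        ((div_lt_one (hR0.trans_lt hzR)).2 hzR)).const_mul C
      simpa using this
    refine squeeze_zero_norm (fun K => ?_) hlim
    rw [norm_mul, norm_pow, norm_inv, div_pow, div_eq_mul_inv, inv_pow]
    calc (‖z‖ ^ K)⁻¹ * ‖cauchyFunctional μ z (X ^ K * p)‖ ≤ (‖z‖ ^ K)⁻¹ * (C * R ^ K) :=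
          mul_le_mul_of_nonneg_left (hC K) (by positivity)
      _ = C * (R ^ K * (‖z‖ ^ K)⁻¹) := by ring
  have := (tendsto_const_nhds (x := cauchyFunctional μ z p)).sub hrem
  rw [sub_zero] at this
  refine this.congr fun K => ?_
  rw [sub_eq_iff_eq_add]
  exact cauchyFunctional_eq_sum_add hc hz h0 p K

theorem isOpen_notMem_support : IsOpen {z : ℂ | z ∉ (fun x : ℝ => (x : ℂ)) '' μ.support} := by
  have : IsClosed ((fun x : ℝ => (x : ℂ)) '' μ.support) :=
    Complex.isometry_ofReal.isClosedEmbedding.isClosedMap _ Measure.isClosed_support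
  exact this.isOpen_compl

theorem markov_eq_cauchyFunctional [IsFiniteMeasure μ] (hc : IsCompact μ.support)
    (hz : z ∉ (fun x : ℝ => (x : ℂ)) '' μ.support) : markov μ z = cauchyFunctional μ z 1 := by
  rw [cauchyFunctional_apply hc hz, markov]; simp

theorem differentiableAt_markov [IsFiniteMeasure μ]
    (hz : z ∉ (fun x : ℝ => (x : ℂ)) '' μ.support) : DifferentiableAt ℂ (markov μ) z := by
  have h := (hasDerivAt_resolventTransform (μ := μ) z hz).differentiableAt.neg
  refine h.congr_of_eventuallyEq (Filter.Eventually.of_forall fun w => ?_)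
  simp only [markov, resolventTransform_apply, Pi.neg_apply]
  rw [← integral_neg]
  congr 1; ext x
  rw [resolvent, Ring.inverse_eq_inv', ← inv_neg, neg_sub, one_div]
  rfl

/-- Multiplication by `X` changes the transform by a factor `z` and a constant, so induction over
monomials reduces to the Markov function. -/
theorem differentiableAt_cauchyFunctional [IsFiniteMeasure μ] (hc : IsCompact μ.support)
    (hz : z ∉ (fun x : ℝ => (x : ℂ)) '' μ.support) (p : ℝ[X]) :
    DifferentiableAt ℂ (fun w => cauchyFunctional μ w p) z := by
  have hX : ∀ n, DifferentiableAt ℂ (fun w => cauchyFunctional μ w (X ^ n)) z := by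
    intro n
    induction n with
    | zero =>
      refine (differentiableAt_markov hz).congr_of_eventuallyEq ?_
      filter_upwards [isOpen_notMem_support.mem_nhds hz] with w hw
      rw [pow_zero, markov_eq_cauchyFunctional hc hw]
    | succ n ih =>
      refine ((differentiableAt_id.mul ih).sub_const
        (momentFunctional μ (X ^ n) : ℂ)).congr_of_eventuallyEq ?_
      filter_upwards [isOpen_notMem_support.mem_nhds hz] with w hw
      rw [pow_succ', cauchyFunctional_X_mul hc hw]
      rfl
  have hp : (fun w => cauchyFunctional μ w p)
      = fun w => ∑ i ∈ Finset.range (p.natDegree + 1), (p.coeff i : ℂ)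
        * cauchyFunctional μ w (X ^ i) := by
    ext w
    conv_lhs => rw [p.as_sum_range_C_mul_X_pow, map_sum]
    refine Finset.sum_congr rfl fun i _ => ?_
    rw [← smul_eq_C_mul, map_smul, Complex.real_smul]
  rw [hp]
  exact DifferentiableAt.fun_sum fun i _ => (hX i).const_mul _

end Cauchy

/-! ### Functions on the tree built from the type I forms -/

section Forms

variable {d : ℕ}

/-- The functional on forms with the given components. -/
def formLift (φ : Fin d → ℝ[X] →ₗ[ℝ] ℂ) : (Fin d → ℝ[X]) →ₗ[ℝ] ℂ :=
  ∑ j, φ j ∘ₗ LinearMap.proj j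

theorem formLift_apply (φ : Fin d → ℝ[X] →ₗ[ℝ] ℂ) (A : Fin d → ℝ[X]) :
    formLift φ A = ∑ j, φ j (A j) := by
  simp [formLift]

/-- `∫ x^k Q` as a complex valued functional of the form `Q`. -/
def momentForm (μ : Fin d → Measure ℝ) (k : ℕ) : (Fin d → ℝ[X]) →ₗ[ℝ] ℂ :=
  formLift fun j => Complex.ofRealCLM.toLinearMap ∘ₗ momentFunctional (μ j) ∘ₗ
    LinearMap.mulRight ℝ (X ^ k)

theorem momentForm_apply (μ : Fin d → Measure ℝ) (k : ℕ) (A : Fin d → ℝ[X]) :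
    momentForm μ k A = (formFunctional μ A (X ^ k) : ℂ) := by
  simp [momentForm, formLift_apply, formFunctional_apply]

theorem momentForm_X_mul (μ : Fin d → Measure ℝ) (k : ℕ) (A : Fin d → ℝ[X]) :
    momentForm μ k (fun i => X * A i) = momentForm μ (k + 1) A := by
  rw [momentForm_apply, momentForm_apply, formFunctional_X_mul, pow_succ']

/-- `∫ Q(x) / (z - x)` as a functional of the form `Q`. -/
def cauchyForm (μ : Fin d → Measure ℝ) (z : ℂ) : (Fin d → ℝ[X]) →ₗ[ℝ] ℂ :=
  formLift fun j => cauchyFunctional (μ j) z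

/-- The function `Y ↦ m_Y⁻¹ F(Q_{Π(Y)})`. -/
def treeLift (μ : Fin d → Measure ℝ) (F : (Fin d → ℝ[X]) →ₗ[ℝ] ℂ) (Y : TreeVertex d) : ℂ :=
  ((treeM μ Y : ℝ) : ℂ)⁻¹ * F (typeI μ (treeProj Y))

end Forms

namespace IsAngelescoSystem

variable {d : ℕ} {μ : Fin d → Measure ℝ} {z : ℂ}

theorem treeM_nil : treeM μ [] = 1 := by simp [treeM, treeW]

theorem inv_treeM_cons (i : Fin d) (Y : TreeVertex d) :
    ((treeM μ (i :: Y) : ℝ) : ℂ)⁻¹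
      = (Real.sqrt (treeW μ (i :: Y)) : ℂ) * ((treeM μ Y : ℝ) : ℂ)⁻¹ := by
  simp [treeM, mul_comm]

theorem treeM_ne_zero (hμ : IsAngelescoSystem μ) (hd : 2 ≤ d) (Y : TreeVertex d) :
    treeM μ Y ≠ 0 := by
  refine List.prod_ne_zero fun h => ?_
  obtain ⟨y, -, hy⟩ := List.mem_map.1 h
  exact (inv_pos.2 (Real.sqrt_pos.2 (hμ.treeW_pos hd y))).ne' hy

theorem map_typeI_recurrence (hμ : IsAngelescoSystem μ) (hd : 2 ≤ d)
    (F : (Fin d → ℝ[X]) →ₗ[ℝ] ℂ) {n : Fin d → ℕ} (hn : ∀ i, 1 ≤ n i) (j : Fin d) :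
    F (fun i => X * typeI μ n i) = F (typeI μ (n - Pi.single j 1))
      + (recB μ (n - Pi.single j 1) j : ℂ) * F (typeI μ n)
      + ∑ l, (recA μ n l : ℂ) * F (typeI μ (n + Pi.single l 1)) := by
  have h : (fun i => X * typeI μ n i) = typeI μ (n - Pi.single j 1)
      + recB μ (n - Pi.single j 1) j • typeI μ n
      + ∑ l, recA μ n l • typeI μ (n + Pi.single l 1) := by
    funext i
    simp only [hμ.recA_eq hd, hμ.recB_eq hd, Pi.add_apply, Pi.smul_apply, Finset.sum_apply,
      smul_eq_C_mul]
    exact hμ.typeI_recurrence hd hn j i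
  rw [h, map_add, map_add, map_sum, map_smul, Complex.real_smul]
  simp only [map_smul, Complex.real_smul]

theorem sum_children (hμ : IsAngelescoSystem μ) (hd : 2 ≤ d) (F : (Fin d → ℝ[X]) →ₗ[ℝ] ℂ)
    (Y : TreeVertex d) :
    ∑ i, (Real.sqrt (treeW μ (i :: Y)) : ℂ) * treeLift μ F (i :: Y)
      = ((treeM μ Y : ℝ) : ℂ)⁻¹ * ∑ i, (recA μ (treeProj Y) i : ℂ) *
        F (typeI μ (treeProj Y + Pi.single i 1)) := by
  rw [Finset.mul_sum]
  refine Finset.sum_congr rfl fun i _ => ?_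
  have hs : (Real.sqrt (treeW μ (i :: Y)) : ℂ) * (Real.sqrt (treeW μ (i :: Y)) : ℂ)
      = (recA μ (treeProj Y) i : ℂ) := by
    rw [← Complex.ofReal_mul, Real.mul_self_sqrt (hμ.treeW_pos hd _).le, treeW]
  rw [treeLift, inv_treeM_cons, ← hs, treeProj]
  ring

/-- The Jacobi matrix acts on `m⁻¹ F(Q)` as multiplication of the forms by `x`, up to a rank one
term at the root. -/
theorem jacobiAction_treeLift (hμ : IsAngelescoSystem μ) (hd : 2 ≤ d) {κ : Fin d → ℝ}
    (hκ : ∑ j, κ j = 1) (F : (Fin d → ℝ[X]) →ₗ[ℝ] ℂ) (Y : TreeVertex d) :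
    jacobiAction μ κ (treeLift μ F) Y
      = ((treeM μ Y : ℝ) : ℂ)⁻¹ * F (fun i => X * typeI μ (treeProj Y) i)
        - (∑ j, (κ j : ℂ) * F (typeI μ (1 - Pi.single j 1))) * treeDelta [] Y := by
  have hpos := treeProj_pos Y
  cases Y with
  | nil =>
    have hκ' : ∑ j, (κ j : ℂ) = 1 := by exact_mod_cast hκ
    -- At the root there is a recurrence for each direction `j`; they are averaged with the weights
    -- `κ j`, whose sum is 1.
    have h1 : F (fun i => X * typeI μ 1 i) = ∑ j, (κ j : ℂ) * (F (typeI μ (1 - Pi.single j 1))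
      + (recB μ (1 - Pi.single j 1) j : ℂ) * F (typeI μ 1)
      + ∑ l, (recA μ 1 l : ℂ) * F (typeI μ (1 + Pi.single l 1))) := by
      rw [← one_mul (F _), ← hκ', Finset.sum_mul]
      exact Finset.sum_congr rfl fun j _ => by
        rw [hμ.map_typeI_recurrence hd F (n := 1) (fun i => le_rfl) j]
    simp only [mul_add, Finset.sum_add_distrib, ← Finset.sum_mul, hκ', one_mul,
      ← mul_assoc] at h1
    rw [jacobiAction, hμ.sum_children hd]
    simp only [treeDelta_apply, if_pos, mul_one, treeLift, treeM_nil, treeProj, treeV,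
      Complex.ofReal_sum, Complex.ofReal_mul, Complex.ofReal_one, inv_one, one_mul]
    rw [h1]
    ring
  | cons l Y =>
    have hsub : treeProj (l :: Y) - Pi.single l 1 = treeProj Y := by
      rw [treeProj]; ext i; simp
    rw [hμ.map_typeI_recurrence hd F hpos l, hsub, jacobiAction, hμ.sum_children hd,
      treeDelta_apply, if_neg (by simp), mul_zero, sub_zero]
    rw [treeLift, treeLift, inv_treeM_cons, treeV]
    ring

/-- Since `|Π(Y)| ≥ d ≥ 2`, the zeroth moment is among the vanishing ones. This removes the
inhomogeneous term from the equation for `L` and starts the moment recursion at 0. -/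
theorem momentForm_zero_typeI (hμ : IsAngelescoSystem μ) (hd : 2 ≤ d) (Y : TreeVertex d) :
    momentForm μ 0 (typeI μ (treeProj Y)) = 0 := by
  have := multiSize_of_forall_one_le (treeProj_pos Y)
  rw [momentForm_apply, hμ.formFunctional_typeI_X_pow (by omega), if_neg (by omega),
    Complex.ofReal_zero]

theorem cauchyForm_X_mul (hμ : IsAngelescoSystem μ)
    (hz : ∀ j, z ∉ (fun x : ℝ => (x : ℂ)) '' (μ j).support) (A : Fin d → ℝ[X]) :
    cauchyForm μ z (fun i => X * A i) = z * cauchyForm μ z A - momentForm μ 0 A := by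
  simp only [cauchyForm, momentForm, formLift_apply, Finset.mul_sum, ← Finset.sum_sub_distrib]
  refine Finset.sum_congr rfl fun j _ => ?_
  have := hμ.finite j
  rw [cauchyFunctional_X_mul (hμ.compact_support j) (hz j)]
  simp

theorem secondKindL_eq (hμ : IsAngelescoSystem μ)
    (hz : ∀ j, z ∉ (fun x : ℝ => (x : ℂ)) '' (μ j).support) (n : Fin d → ℕ) :
    secondKindL μ n z = cauchyForm μ z (typeI μ n) := by
  rw [secondKindL, cauchyForm, formLift_apply]
  refine Finset.sum_congr rfl fun j _ => ?_
  have := hμ.finite j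
  rw [cauchyFunctional_apply (hμ.compact_support j) (hz j)]

theorem treeL_eq (hμ : IsAngelescoSystem μ)
    (hz : ∀ j, z ∉ (fun x : ℝ => (x : ℂ)) '' (μ j).support) (Y : TreeVertex d) :
    treeL μ z Y = treeLift μ (cauchyForm μ z) Y := by
  rw [treeL, hμ.secondKindL_eq hz, treeLift]

theorem gammaMarkov_eq (hμ : IsAngelescoSystem μ) (κ : Fin d → ℝ)
    (hz : ∀ j, z ∉ (fun x : ℝ => (x : ℂ)) '' (μ j).support) :
    gammaMarkov μ κ z = -∑ j, (κ j : ℂ) * cauchyForm μ z (typeI μ (1 - Pi.single j 1)) := by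
  have hcauchy : ∀ j i, cauchyFunctional (μ i) z (typeI μ (1 - Pi.single j 1) i)
      = ((typeI μ (1 - Pi.single j 1) i).coeff 0 : ℂ) * markov (μ i) z := by
    intro j i
    have := hμ.finite i
    have hdeg := (hμ.isTypeI_typeI (1 - Pi.single j 1)).degree_lt i
    have hle : ((1 - Pi.single j 1 : Fin d → ℕ) i : WithBot ℕ) ≤ (1 : ℕ) := by
      exact_mod_cast (show (1 - Pi.single j 1 : Fin d → ℕ) i ≤ 1 by simp)
    have h0 := eq_C_of_degree_le_zero (Nat.WithBot.lt_one_iff_le_zero.1 (hdeg.trans_le hle))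
    conv_lhs => rw [h0, ← mul_one (C _), ← smul_eq_C_mul, map_smul, Complex.real_smul]
    rw [markov_eq_cauchyFunctional (hμ.compact_support i) (hz i)]
  simp only [gammaMarkov, gammaCoeff, cauchyForm, formLift_apply, hcauchy, Complex.ofReal_neg,
    Complex.ofReal_sum, Complex.ofReal_mul, neg_mul, Finset.sum_neg_distrib, Finset.sum_mul,
    Finset.mul_sum]
  rw [Finset.sum_comm]
  simp only [mul_assoc]

/-- The functions of the second kind solve the spectral equation up to the root. -/
theorem jacobiAction_treeL (hμ : IsAngelescoSystem μ) (hd : 2 ≤ d) {κ : Fin d → ℝ}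
    (hκ : ∑ j, κ j = 1) (hz : ∀ j, z ∉ (fun x : ℝ => (x : ℂ)) '' (μ j).support)
    (Y : TreeVertex d) :
    jacobiAction μ κ (treeL μ z) Y = z * treeL μ z Y + gammaMarkov μ κ z * treeDelta [] Y := by
  have : treeL μ z = treeLift μ (cauchyForm μ z) := funext (hμ.treeL_eq hz)
  rw [this, hμ.jacobiAction_treeLift hd hκ, hμ.cauchyForm_X_mul hz, hμ.momentForm_zero_typeI hd,
    hμ.gammaMarkov_eq κ hz, treeLift]
  ring

/-! ### Square summability near infinity -/

theorem exists_norm_momentForm_le (hμ : IsAngelescoSystem μ) {R : ℝ}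
    (hR : ∀ j, ∀ x ∈ convexHull ℝ (μ j).support, |x| ≤ R) (A : Fin d → ℝ[X]) :
    ∃ C : ℝ, ∀ k, ‖momentForm μ k A‖ ≤ C * R ^ k := by
  have : ∀ j, ∃ C : ℝ, ∀ k : ℕ, |momentFunctional (μ j) (A j * X ^ k)| ≤ C * R ^ k := fun j => by
    have := hμ.finite j
    exact norm_momentFunctional_le (hμ.compact_support j)
      (fun x hx => hR j x (subset_convexHull ℝ _ hx)) (A j)
  choose C hC using this
  refine ⟨∑ j, C j, fun k => ?_⟩
  rw [momentForm_apply, Complex.norm_real, Real.norm_eq_abs, formFunctional_apply,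
    Finset.sum_mul]
  exact (Finset.abs_sum_le_sum_abs _ _).trans (Finset.sum_le_sum fun j _ => hC j k)

/-- Multiplying the forms by `x` raises the moment order by one, so the moment vectors obey `t_{k+1}
= J t_k + g_k e_O` with `t_0 = 0`. Square summability is thus inherited from the boundedness of `J`,
without any asymptotics of the `Q_n`. -/
theorem exists_moment_vectors (hμ : IsAngelescoSystem μ) (hd : 2 ≤ d) {κ : Fin d → ℝ}
    (hκ : ∑ j, κ j = 1) {J : TreeL2 d →L[ℂ] TreeL2 d}
    (hJ : ∀ (f : TreeL2 d) (Y : TreeVertex d), J f Y = jacobiAction μ κ (fun X => f X) Y) :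
    ∃ (ρ C : ℝ) (t : ℕ → TreeL2 d), 0 ≤ ρ ∧ (∀ k, ‖t k‖ ≤ C * ρ ^ k) ∧
      ∀ k Y, t k Y = treeLift μ (momentForm μ k) Y := by
  obtain ⟨R, hR0, hR⟩ := hμ.exists_hull_bound
  have hg : ∃ C : ℝ, ∀ k, ‖∑ j, (κ j : ℂ) * momentForm μ k (typeI μ (1 - Pi.single j 1))‖
      ≤ C * R ^ k := by
    choose C hC using fun j : Fin d => hμ.exists_norm_momentForm_le hR (typeI μ (1 - Pi.single j 1))
    refine ⟨∑ j, |κ j| * C j, fun k => (norm_sum_le _ _).trans ?_⟩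
    rw [Finset.sum_mul]
    refine Finset.sum_le_sum fun j _ => ?_
    rw [norm_mul, Complex.norm_real, Real.norm_eq_abs, mul_assoc]
    exact mul_le_mul_of_nonneg_left (hC j k) (abs_nonneg _)
  obtain ⟨C, hC⟩ := hg
  set g : ℕ → ℂ := fun k => ∑ j, (κ j : ℂ) * momentForm μ k (typeI μ (1 - Pi.single j 1)) with hgdef
  have hC0 : 0 ≤ C := by simpa using (norm_nonneg _).trans (hC 0)
  let t : ℕ → TreeL2 d := fun k => Nat.rec 0 (fun k v => J v + g k • treeDelta []) k
  have ht0 : t 0 = 0 := rfl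
  have hts : ∀ k, t (k + 1) = J (t k) + g k • treeDelta [] := fun k => rfl
  have hJn := norm_nonneg J
  have hδ : ‖(treeDelta [] : TreeL2 d)‖ = 1 := by
    rw [treeDelta, lp.norm_single (by norm_num)]; simp
  -- Any rate at least `R` and at least `‖J‖ + 1` closes the induction, since `g_k` is at most `C *
  -- R ^ k`.
  refine ⟨R + ‖J‖ + 1, C, t, by positivity, fun k => ?_, fun k => ?_⟩
  · induction k with
    | zero => simpa [ht0] using hC0
    | succ k ih =>
      rw [hts]
      refine (norm_add_le _ _).trans ?_
      rw [norm_smul, hδ, mul_one]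
      have h1 : ‖J (t k)‖ ≤ ‖J‖ * (C * (R + ‖J‖ + 1) ^ k) :=
        (J.le_opNorm _).trans (mul_le_mul_of_nonneg_left ih hJn)
      have h2 : ‖g k‖ ≤ C * (R + ‖J‖ + 1) ^ k := (hC k).trans
        (mul_le_mul_of_nonneg_left (pow_le_pow_left₀ hR0 (by linarith) k) hC0)
      have h3 : 0 ≤ C * (R + ‖J‖ + 1) ^ k * R := by positivity
      rw [pow_succ]
      nlinarith
  · induction k with
    | zero =>
      intro Y
      rw [ht0, treeLift, hμ.momentForm_zero_typeI hd, mul_zero]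
      rfl
    | succ k ih =>
      intro Y
      have hfun : (fun X => t k X) = treeLift μ (momentForm μ k) := funext ih
      rw [hts, lp.coeFn_add, lp.coeFn_smul, Pi.add_apply, Pi.smul_apply, smul_eq_mul, hJ, hfun,
        hμ.jacobiAction_treeLift hd hκ, momentForm_X_mul, hgdef, treeLift]
      ring

/-- For `|z| > R` the Laurent series of the Cauchy transforms converges at each vertex, and for `|z|
> ρ` the series of moment vectors converges in `ℓ²`; the two limits agree at every vertex. -/
theorem exists_treeL_of_norm_gt (hμ : IsAngelescoSystem μ) (hd : 2 ≤ d) {κ : Fin d → ℝ}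
    (hκ : ∑ j, κ j = 1) {J : TreeL2 d →L[ℂ] TreeL2 d}
    (hJ : ∀ (f : TreeL2 d) (Y : TreeVertex d), J f Y = jacobiAction μ κ (fun X => f X) Y) :
    ∃ r : ℝ, ∀ z : ℂ, r < ‖z‖ → ∃ l : TreeL2 d, ∀ Y, l Y = treeL μ z Y := by
  obtain ⟨ρ, C, t, hρ, htn, ht⟩ := hμ.exists_moment_vectors hd hκ hJ
  obtain ⟨R, hR0, hR⟩ := hμ.exists_hull_bound
  refine ⟨R + ρ, fun z hz => ?_⟩
  have hz0 : 0 < ‖z‖ := by linarith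
  have hzs : ∀ j, z ∉ (fun x : ℝ => (x : ℂ)) '' (μ j).support := by
    rintro j ⟨x, hx, rfl⟩
    simp only [Complex.norm_real, Real.norm_eq_abs] at hz
    have := hR j x (subset_convexHull ℝ _ hx)
    linarith
  have hsum : Summable fun k => z⁻¹ ^ (k + 1) • t k := by
    have hgeo : Summable fun k : ℕ => C * ‖z‖⁻¹ * (ρ / ‖z‖) ^ k :=
      (summable_geometric_of_lt_one (by positivity) ((div_lt_one hz0).2 (by linarith))).mul_left _
    refine Summable.of_norm_bounded hgeo fun k => ?_
    rw [norm_smul, norm_pow, norm_inv]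
    calc ‖z‖⁻¹ ^ (k + 1) * ‖t k‖ ≤ ‖z‖⁻¹ ^ (k + 1) * (C * ρ ^ k) :=
          mul_le_mul_of_nonneg_left (htn k) (by positivity)
      _ = C * ‖z‖⁻¹ * (ρ / ‖z‖) ^ k := by rw [div_eq_mul_inv, mul_pow, pow_succ]; ring
  refine ⟨∑' k, z⁻¹ ^ (k + 1) • t k, fun Y => ?_⟩
  have h1 : Filter.Tendsto (fun K => ∑ k ∈ Finset.range K, z⁻¹ ^ (k + 1) * t k Y) Filter.atTop
      (nhds ((∑' k, z⁻¹ ^ (k + 1) • t k : TreeL2 d) Y)) := by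
    have := ((lp.evalCLM (𝕜 := ℂ) (E := fun _ : TreeVertex d => ℂ) (p := 2) Y).continuous.tendsto
      _).comp hsum.hasSum.tendsto_sum_nat
    refine this.congr fun K => ?_
    simp only [Function.comp_apply, map_sum, map_smul, smul_eq_mul]
    rfl
  refine tendsto_nhds_unique h1 ?_
  rw [hμ.treeL_eq hzs, treeLift, cauchyForm, formLift_apply]
  have h2 : Filter.Tendsto (fun K => ((treeM μ Y : ℝ) : ℂ)⁻¹ * ∑ j, ∑ k ∈ Finset.range K,
      z⁻¹ ^ (k + 1) * (momentFunctional (μ j) (typeI μ (treeProj Y) j * X ^ k) : ℂ)) Filter.atTop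
      (nhds (((treeM μ Y : ℝ) : ℂ)⁻¹ *
        ∑ j, cauchyFunctional (μ j) z (typeI μ (treeProj Y) j))) := by
    refine (tendsto_finsetSum _ fun j _ => ?_).const_mul _
    have := hμ.finite j
    exact tendsto_cauchyFunctional (hμ.compact_support j)
      (fun x hx => hR j x (subset_convexHull ℝ _ hx)) hR0 (by linarith) _
  refine h2.congr fun K => ?_
  rw [Finset.sum_comm, Finset.mul_sum]
  refine Finset.sum_congr rfl fun k _ => ?_
  rw [ht, treeLift, momentForm_apply, formFunctional_apply, Complex.ofReal_sum, ← Finset.mul_sum]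
  ring

end IsAngelescoSystem

theorem ringInverse_neg {R : Type*} [Ring R] (a : R) : Ring.inverse (-a) = -Ring.inverse a := by
  by_cases h : IsUnit a
  · obtain ⟨u, rfl⟩ := h
    rw [← Units.val_neg, Ring.inverse_unit, Ring.inverse_unit, inv_neg, Units.val_neg]
  · rw [Ring.inverse_non_unit _ h, Ring.inverse_non_unit _ (by rwa [IsUnit.neg_iff]), neg_zero]

/-! ### Nonvanishing -/

/-- The Cauchy transform is not a combination of finitely many moments. -/
theorem exists_cauchyFunctional_ne_zero {μ : Measure ℝ} [IsFiniteMeasure μ]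
    (hc : IsCompact μ.support) (hi : μ.support.Infinite) {z : ℂ}
    (hz : z ∉ (fun x : ℝ => (x : ℂ)) '' μ.support) (m : ℕ) :
    ∃ p : ℝ[X], (∀ l < m, momentFunctional μ (p * X ^ l) = 0) ∧ cauchyFunctional μ z p ≠ 0 := by
  by_contra! hcon
  let L : Fin m → ℝ[X] →ₗ[ℝ] ℝ := fun l => momentFunctional μ ∘ₗ LinearMap.mulRight ℝ (X ^ (l : ℕ))
  -- A functional that vanishes on the common kernel of finitely many functionals is a combination
  -- of them.
  have hspan : ∀ K : ℂ →ₗ[ℝ] ℝ, ∃ c : Fin m → ℝ, ∀ p : ℝ[X],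
      K (cauchyFunctional μ z p) = ∑ l, c l * momentFunctional μ (p * X ^ (l : ℕ)) := by
    intro K
    have hker : ⨅ l, LinearMap.ker (L l) ≤ LinearMap.ker (K ∘ₗ cauchyFunctional μ z) := by
      intro p hp
      rw [Submodule.mem_iInf] at hp
      rw [LinearMap.mem_ker, LinearMap.comp_apply, hcon p fun l hl => hp ⟨l, hl⟩, map_zero]
    obtain ⟨c, hc⟩ := (Submodule.mem_span_range_iff_exists_fun ℝ).1 (mem_span_of_iInf_ker_le_ker hker)
    refine ⟨c, fun p => ?_⟩
    rw [← LinearMap.comp_apply, ← hc]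
    simp [L]
  obtain ⟨c, hre⟩ := hspan Complex.reLm
  obtain ⟨e, him⟩ := hspan Complex.imLm
  simp only [Complex.reLm_coe, Complex.imLm_coe] at hre him
  -- `u` and `v` are the real and imaginary parts, for real `X`, of `1 + (X - z) ∑ (c l + i e l) X ^
  -- l`. The relation for multiplication by `X` makes both orthogonal to every polynomial, hence
  -- zero, while `u + i v` takes the value 1 at `z`.
  let u : ℝ[X] := 1 + ∑ l : Fin m, (C (c l) * X ^ (l + 1 : ℕ)
    - C (z.re * c l - z.im * e l) * X ^ (l : ℕ))
  let v : ℝ[X] := ∑ l : Fin m, (C (e l) * X ^ (l + 1 : ℕ)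
    - C (z.re * e l + z.im * c l) * X ^ (l : ℕ))
  have hmom : ∀ (p : ℝ[X]) (a : ℝ) (l : ℕ),
      momentFunctional μ (p * (C a * X ^ l)) = a * momentFunctional μ (p * X ^ l) := by
    intro p a l
    rw [mul_left_comm, ← smul_eq_C_mul, map_smul, smul_eq_mul]
  have hX : ∀ (p : ℝ[X]) (l : ℕ),
      momentFunctional μ (X * p * X ^ l) = momentFunctional μ (p * X ^ (l + 1)) := by
    intro p l; congr 1; ring
  have hterm : ∀ (p : ℝ[X]) (a b : ℝ) (l : ℕ),
      momentFunctional μ (p * (C a * X ^ (l + 1) - C b * X ^ l))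
        = a * momentFunctional μ (p * X ^ (l + 1)) - b * momentFunctional μ (p * X ^ l) := by
    intro p a b l
    rw [mul_sub, map_sub, hmom, hmom]
  have hu : ∀ p, momentFunctional μ (p * u) = 0 := by
    intro p
    have h := congrArg Complex.re (cauchyFunctional_X_mul hc hz p)
    rw [Complex.sub_re, Complex.mul_re, hre, hre, him, Complex.ofReal_re] at h
    simp only [hX, Finset.mul_sum] at h
    simp only [u, mul_add, mul_one, map_add, Finset.mul_sum, map_sum, hterm]
    rw [Finset.sum_sub_distrib, h]
    simp only [sub_mul, mul_assoc, Finset.sum_sub_distrib]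
    ring
  have hv : ∀ p, momentFunctional μ (p * v) = 0 := by
    intro p
    have h := congrArg Complex.im (cauchyFunctional_X_mul hc hz p)
    rw [Complex.sub_im, Complex.mul_im, him, hre, him, Complex.ofReal_im] at h
    simp only [hX, Finset.mul_sum] at h
    simp only [v, Finset.mul_sum, map_sum, hterm]
    rw [Finset.sum_sub_distrib, h]
    simp only [add_mul, mul_assoc, Finset.sum_add_distrib]
    ring
  have hzero : ∀ q : ℝ[X], (∀ p, momentFunctional μ (p * q) = 0) → q = 0 := by
    intro q hq
    by_contra h0
    exact (momentFunctional_pos hc hi (mul_ne_zero h0 h0)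
      fun x _ => by rw [eval_mul]; exact mul_self_nonneg _).ne' (hq q)
  have hu0 := congrArg (aeval z) (hzero u hu)
  have hv0 := congrArg (aeval z) (hzero v hv)
  simp only [u, v, map_add, map_one, map_sum, map_sub, map_mul, aeval_C, map_pow, aeval_X,
    map_zero, Complex.coe_algebraMap] at hu0 hv0
  have hsum : (1 : ℂ) = 0 := by
    have h1 : ∑ l : Fin m, (((c l : ℂ) * z ^ (l + 1 : ℕ) - ((z.re : ℂ) * c l - z.im * e l) * z ^ (l : ℕ))
        + Complex.I * ((e l : ℂ) * z ^ (l + 1 : ℕ) - ((z.re : ℂ) * e l + z.im * c l) * z ^ (l : ℕ)))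
        = 0 := by
      refine Finset.sum_eq_zero fun l _ => ?_
      have hz' := Complex.re_add_im z
      have hI := Complex.I_sq
      linear_combination (-(c l + Complex.I * e l) * z ^ (l : ℕ)) * hz'
        + (z.im * e l * z ^ (l : ℕ)) * hI
    rw [Finset.sum_add_distrib, ← Finset.mul_sum, hv0, mul_zero, add_zero] at h1
    rwa [h1, add_zero] at hu0
  exact one_ne_zero hsum

namespace IsAngelescoSystem

variable {d : ℕ} {μ : Fin d → Measure ℝ} {z : ℂ}

/-- Forms with `d - 1` vanishing moments are spanned by the forms `Q_{Π(Y)}`. -/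
theorem map_eq_zero_of_map_typeI_eq_zero (hμ : IsAngelescoSystem μ)
    (F : (Fin d → ℝ[X]) →ₗ[ℝ] ℂ) (hF : ∀ Y, F (typeI μ (treeProj Y)) = 0) (Y : TreeVertex d)
    (A : Fin d → ℝ[X]) (hdeg : ∀ j, (A j).degree < treeProj Y j)
    (hA : ∀ l, l + 1 < d → formFunctional μ A (X ^ l) = 0) : F A = 0 := by
  have hlin : ∀ (c : ℝ) (A B : Fin d → ℝ[X]) (q : ℝ[X]), formFunctional μ (A - c • B) q
      = formFunctional μ A q - c * formFunctional μ B q := by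
    intro c A B q
    have h : A - c • B = fun i => A i - C c * B i := by funext i; simp [smul_eq_C_mul]
    rw [h, formFunctional_sub, formFunctional_C_mul]
  have hdegsub : ∀ (A : Fin d → ℝ[X]) (c : ℝ) (Z : TreeVertex d),
      (∀ j, (A j).degree < treeProj Z j) →
      ∀ j, ((A - c • typeI μ (treeProj Z)) j).degree < treeProj Z j := fun A c Z hZ j =>
    (degree_sub_le _ _).trans_lt (max_lt (hZ j)
      ((degree_smul_le _ _).trans_lt ((hμ.isTypeI_typeI _).degree_lt j)))
  have hback : ∀ (A : Fin d → ℝ[X]) (c : ℝ) (Z : TreeVertex d),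
      F (A - c • typeI μ (treeProj Z)) = 0 → F A = 0 := by
    intro A c Z h
    rwa [map_sub, map_smul, hF, smul_zero, sub_zero] at h
  induction Y generalizing A with
  | nil =>
    have hsize : multiSize (treeProj ([] : TreeVertex d)) = d := by simp [multiSize, treeProj]
    -- At the root the index has size `d`, so one moment remains to be cancelled, namely the one
    -- normalized to 1 for `Q_{(1,…,1)}`.
    refine hback A (formFunctional μ A (X ^ (d - 1))) [] ?_
    rw [hμ.form_eq_zero (n := treeProj []) (hdegsub A _ [] hdeg), map_zero]
    intro l hl
    rw [hlin, hμ.formFunctional_typeI_X_pow hl]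
    rw [hsize] at hl ⊢
    split_ifs with h
    · rw [show d - 1 = l by omega]; ring
    · rw [hA l (by omega)]; ring
  | cons i Y ih =>
    have hd := multiSize_of_forall_one_le (treeProj_pos Y)
    have hs := multiSize_add_single (treeProj Y) i
    -- The factor removes the top coefficient of the `i`-th component, as the top coefficient of the
    -- type I polynomial is the inverse norm. The first `d - 1` moments stay zero.
    refine hback A ((A i).coeff (treeProj Y i) * typeIINorm μ (treeProj Y) i) (i :: Y) ?_
    refine ih _ (fun j => ?_) fun l hl => ?_
    · rw [degree_lt_iff_coeff_zero]
      intro k hk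
      rcases eq_or_ne j i with rfl | hji
      · rcases hk.eq_or_lt with rfl | hk
        · have := hμ.coeff_typeI_mul_typeIINorm (treeProj Y) j
          simp only [Pi.sub_apply, Pi.smul_apply, coeff_sub, coeff_smul, smul_eq_mul, treeProj]
          linear_combination (-(A j).coeff (treeProj Y j)) * this
        · refine coeff_eq_zero_of_degree_lt ((hdegsub A _ (j :: Y) hdeg j).trans_le ?_)
          exact_mod_cast (show treeProj (j :: Y) j ≤ k by simp [treeProj]; omega)
      · refine coeff_eq_zero_of_degree_lt ((hdegsub A _ (i :: Y) hdeg j).trans_le ?_)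
        exact_mod_cast (show treeProj (i :: Y) j ≤ k by simpa [treeProj, hji] using hk)
    · rw [hlin, hA l hl, treeProj, hμ.formFunctional_typeI_X_pow (by omega), if_neg (by omega)]
      ring

/-- Otherwise the Cauchy transform kills every form spanned by the `Q_{Π(Y)}`. A form `p dμ_o` with
`d - 1` vanishing moments is one of these, reached along the path that always steps in direction
`o`, but its transform can be nonzero. -/
theorem exists_treeL_ne_zero (hμ : IsAngelescoSystem μ) (hd : 2 ≤ d)
    (hz : ∀ j, z ∉ (fun x : ℝ => (x : ℂ)) '' (μ j).support) :
    ∃ Y : TreeVertex d, treeL μ z Y ≠ 0 := by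
  by_contra! hcon
  have hF : ∀ Y, cauchyForm μ z (typeI μ (treeProj Y)) = 0 := by
    intro Y
    have h := hcon Y
    rw [hμ.treeL_eq hz, treeLift] at h
    exact (mul_eq_zero.1 h).resolve_left
      (inv_ne_zero (Complex.ofReal_ne_zero.2 (hμ.treeM_ne_zero hd Y)))
  let o : Fin d := ⟨0, by omega⟩
  have := hμ.finite o
  obtain ⟨p, hp, hp0⟩ := exists_cauchyFunctional_ne_zero (hμ.compact_support o)
    (hμ.infinite_support o) (hz o) (d - 1)
  have hproj : ∀ N, treeProj (List.replicate N o) = 1 + N • Pi.single o 1 := by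
    intro N
    induction N with
    | zero => simp [treeProj]
    | succ N ih => rw [List.replicate_succ, treeProj, ih, succ_nsmul, add_assoc]
  have hsingle : ∀ q : ℝ[X], formFunctional μ (Pi.single o p) q = momentFunctional (μ o) (p * q) := by
    intro q
    rw [formFunctional_apply, Finset.sum_eq_single o]
    · simp
    · intro j _ hj; simp [hj]
    · simp
  have h := hμ.map_eq_zero_of_map_typeI_eq_zero (cauchyForm μ z) hF
    (List.replicate p.natDegree o) (Pi.single o p) (fun j => ?_) fun l hl => ?_
  · refine hp0 ?_
    rw [cauchyForm, formLift_apply, Finset.sum_eq_single o] at h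
    · simpa using h
    · intro j _ hj; simp [hj]
    · simp
  · rw [hproj]
    rcases eq_or_ne j o with hj | hj
    · rw [hj, Pi.single_eq_same]
      refine degree_le_natDegree.trans_lt ?_
      simp only [Pi.add_apply, Pi.smul_apply, Pi.single_eq_same, Pi.one_apply, smul_eq_mul, mul_one]
      exact_mod_cast (by omega : p.natDegree < 1 + p.natDegree)
    · simp [hj]
  · rw [hsingle, hp l (by omega)]

/-! ### The resolvent identity -/

theorem isUnit_sub_smul {J : TreeL2 d →L[ℂ] TreeL2 d} (hz : z ∉ spectrum ℂ J) :
    IsUnit (J - z • (1 : TreeL2 d →L[ℂ] TreeL2 d)) := by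
  have := spectrum.notMem_iff.1 hz
  rw [Algebra.algebraMap_eq_smul_one] at this
  simpa using this.neg

theorem eq_opResolvent_of_forall (hμ : IsAngelescoSystem μ) (hd : 2 ≤ d) {κ : Fin d → ℝ}
    (hκ : ∑ j, κ j = 1) {J : TreeL2 d →L[ℂ] TreeL2 d}
    (hJ : ∀ (f : TreeL2 d) (Y : TreeVertex d), J f Y = jacobiAction μ κ (fun X => f X) Y)
    (hz : ∀ j, z ∉ (fun x : ℝ => (x : ℂ)) '' (μ j).support) (hzJ : z ∉ spectrum ℂ J)
    {l : TreeL2 d} (hl : ∀ Y, l Y = treeL μ z Y) :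
    l = gammaMarkov μ κ z • opResolvent J z (treeDelta []) := by
  have hfun : (fun X => l X) = treeL μ z := funext hl
  have h1 : (J - z • (1 : TreeL2 d →L[ℂ] TreeL2 d)) l = gammaMarkov μ κ z • treeDelta [] := by
    ext Y
    have : (J - z • (1 : TreeL2 d →L[ℂ] TreeL2 d)) l = J l - z • l := rfl
    rw [this, lp.coeFn_sub, Pi.sub_apply, lp.coeFn_smul, Pi.smul_apply, lp.coeFn_smul,
      Pi.smul_apply, hJ, hfun, hμ.jacobiAction_treeL hd hκ hz, hl, smul_eq_mul, smul_eq_mul]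
    ring
  rw [← map_smul, ← h1, opResolvent, ← mul_apply_eq_comp,
    Ring.inverse_mul_cancel _ (isUnit_sub_smul hzJ)]
  rfl

/-! ### Analyticity in the spectral parameter and continuation -/

theorem differentiableAt_treeL (hμ : IsAngelescoSystem μ)
    (hz : ∀ j, z ∉ (fun x : ℝ => (x : ℂ)) '' (μ j).support) (Y : TreeVertex d) :
    DifferentiableAt ℂ (fun w => treeL μ w Y) z := by
  have h : DifferentiableAt ℂ (fun w => ((treeM μ Y : ℝ) : ℂ)⁻¹ *
      ∑ j, cauchyFunctional (μ j) w (typeI μ (treeProj Y) j)) z := by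
    refine (DifferentiableAt.fun_sum fun j _ => ?_).const_mul _
    have := hμ.finite j
    exact differentiableAt_cauchyFunctional (hμ.compact_support j) (hz j) _
  refine h.congr_of_eventuallyEq ?_
  have hopen : ∀ᶠ w in nhds z, ∀ j, w ∉ (fun x : ℝ => (x : ℂ)) '' (μ j).support :=
    Filter.eventually_all.2 fun j => isOpen_notMem_support.mem_nhds (hz j)
  filter_upwards [hopen] with w hw
  rw [hμ.treeL_eq hw, treeLift, cauchyForm, formLift_apply]

theorem differentiableAt_gammaMarkov (hμ : IsAngelescoSystem μ) (κ : Fin d → ℝ)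
    (hz : ∀ j, z ∉ (fun x : ℝ => (x : ℂ)) '' (μ j).support) :
    DifferentiableAt ℂ (gammaMarkov μ κ) z := by
  refine DifferentiableAt.fun_sum fun j _ => ?_
  have := hμ.finite j
  exact (differentiableAt_markov (hz j)).const_mul _

theorem differentiableAt_opResolvent {J : TreeL2 d →L[ℂ] TreeL2 d} (hz : z ∉ spectrum ℂ J)
    (f : TreeL2 d) (Y : TreeVertex d) :
    DifferentiableAt ℂ (fun w => opResolvent J w f Y) z := by
  have h : DifferentiableAt ℂ (fun w => opResolvent J w) z := by
    have h1 := (spectrum.hasDerivAt_resolvent_const_left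
      (spectrum.mem_resolventSet_iff.2 (spectrum.notMem_iff.1 hz))).differentiableAt.neg
    refine h1.congr_of_eventuallyEq (Filter.Eventually.of_forall fun w => ?_)
    simp only [Pi.neg_apply, resolvent, opResolvent]
    rw [← ringInverse_neg, neg_sub, Algebra.algebraMap_eq_smul_one]
  have h2 : DifferentiableAt ℂ (fun w => opResolvent J w f) z :=
    h.clm_apply (differentiableAt_const f)
  exact (lp.evalCLM (𝕜 := ℂ) (E := fun _ : TreeVertex d => ℂ) (p := 2)
    Y).differentiableAt.comp z h2

theorem ofReal_notMem_of_im_ne_zero (hz : z.im ≠ 0) (s : Set ℝ) :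
    z ∉ (fun x : ℝ => (x : ℂ)) '' s := by
  rintro ⟨x, -, rfl⟩
  simp at hz

theorem notMem_spectrum_of_im_ne_zero {J : TreeL2 d →L[ℂ] TreeL2 d} (hJ : IsSelfAdjoint J)
    (hz : z.im ≠ 0) : z ∉ spectrum ℂ J := fun h => hz (by
  rw [hJ.mem_spectrum_eq_re h]; simp)

theorem treeL_eq_of_im_ne_zero (hμ : IsAngelescoSystem μ) (hd : 2 ≤ d) {κ : Fin d → ℝ}
    (hκ : ∑ j, κ j = 1) {J : TreeL2 d →L[ℂ] TreeL2 d} (hJs : IsSelfAdjoint J)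
    (hJ : ∀ (f : TreeL2 d) (Y : TreeVertex d), J f Y = jacobiAction μ κ (fun X => f X) Y)
    (hz : z.im ≠ 0) (Y : TreeVertex d) :
    treeL μ z Y = gammaMarkov μ κ z * opResolvent J z (treeDelta []) Y := by
  obtain ⟨r, hr⟩ := hμ.exists_treeL_of_norm_gt hd hκ hJ
  -- the half plane containing `z`
  set H : Set ℂ := {w | 0 < z.im * w.im} with hH
  have hHim : ∀ w ∈ H, w.im ≠ 0 := fun w hw => right_ne_zero_of_mul (ne_of_gt hw)
  have hHo : IsOpen H := isOpen_lt continuous_const (by fun_prop)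
  have hHc : IsPreconnected H := by
    refine Convex.isPreconnected fun x hx y hy a b ha hb hab => ?_
    simp only [hH, Set.mem_ofPred_eq, Complex.add_im, Complex.real_smul,
      Complex.im_ofReal_mul] at hx hy ⊢
    rcases ha.eq_or_lt with rfl | ha
    · have : b = 1 := by linarith
      subst this; linarith
    · nlinarith [mul_pos ha hx, mul_nonneg hb hy.le]
  have h1 : DifferentiableOn ℂ (fun w => treeL μ w Y) H := fun w hw =>
    (hμ.differentiableAt_treeL (fun j => ofReal_notMem_of_im_ne_zero (hHim w hw) _)
      Y).differentiableWithinAt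
  have h2 : DifferentiableOn ℂ (fun w => gammaMarkov μ κ w * opResolvent J w (treeDelta []) Y) H :=
    fun w hw => ((hμ.differentiableAt_gammaMarkov κ
      (fun j => ofReal_notMem_of_im_ne_zero (hHim w hw) _)).mul
        (differentiableAt_opResolvent (notMem_spectrum_of_im_ne_zero hJs (hHim w hw)) _
          Y)).differentiableWithinAt
  -- a point of the half plane of large modulus
  set w₀ : ℂ := ((|r| + 1) / |z.im| : ℝ) * z with hw₀
  have hzi : 0 < |z.im| := abs_pos.2 hz
  have hw₀H : w₀ ∈ H := by
    have : 0 < (|r| + 1) / |z.im| := by positivity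
    rw [hH, Set.mem_ofPred_eq, hw₀, Complex.im_ofReal_mul]
    have := mul_pos this (mul_self_pos.2 hz)
    linarith
  have hw₀r : r < ‖w₀‖ := by
    rw [hw₀, norm_mul, Complex.norm_real, Real.norm_of_nonneg (by positivity), div_mul_eq_mul_div,
      lt_div_iff₀ hzi]
    nlinarith [Complex.abs_im_le_norm z, le_abs_self r, abs_nonneg r]
  have hev : (fun w => treeL μ w Y) =ᶠ[nhds w₀]
      fun w => gammaMarkov μ κ w * opResolvent J w (treeDelta []) Y := by
    filter_upwards [(isOpen_lt continuous_const continuous_norm).mem_nhds hw₀r,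
      hHo.mem_nhds hw₀H] with w hw hwH
    obtain ⟨l, hl⟩ := hr w hw
    have := hμ.eq_opResolvent_of_forall hd hκ hJ
      (fun j => ofReal_notMem_of_im_ne_zero (hHim w hwH) _)
      (notMem_spectrum_of_im_ne_zero hJs (hHim w hwH)) hl
    rw [← hl, this]
    rfl
  exact (h1.analyticOnNhd hHo).eqOn_of_preconnected_of_eventuallyEq (h2.analyticOnNhd hHo) hHc
    hw₀H hev (mul_self_pos.2 hz)

/-- A real admissible point may lie in a bounded gap of the spectrum. It is approached vertically
through nonreal points, and both sides are continuous there, so no continuation across the real axis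
is needed. -/
theorem treeL_eq_gammaMarkov_mul (hμ : IsAngelescoSystem μ) (hd : 2 ≤ d) {κ : Fin d → ℝ}
    (hκ : ∑ j, κ j = 1) {J : TreeL2 d →L[ℂ] TreeL2 d} (hJs : IsSelfAdjoint J)
    (hJ : ∀ (f : TreeL2 d) (Y : TreeVertex d), J f Y = jacobiAction μ κ (fun X => f X) Y)
    (hz : ∀ j, z ∉ (fun x : ℝ => (x : ℂ)) '' (μ j).support) (hzJ : z ∉ spectrum ℂ J)
    (Y : TreeVertex d) :
    treeL μ z Y = gammaMarkov μ κ z * opResolvent J z (treeDelta []) Y := by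
  by_cases him : z.im = 0
  · have hcurve : Filter.Tendsto (fun t : ℝ => z + t * Complex.I) (nhdsWithin 0 {0}ᶜ) (nhds z) := by
      have : ContinuousAt (fun t : ℝ => z + t * Complex.I) 0 := by fun_prop
      have h := this.tendsto
      simp only [Complex.ofReal_zero, zero_mul, add_zero] at h
      exact h.mono_left nhdsWithin_le_nhds
    have h1 := (hμ.differentiableAt_treeL hz Y).continuousAt.tendsto.comp hcurve
    have h2 := ((hμ.differentiableAt_gammaMarkov κ hz).mul
      (differentiableAt_opResolvent hzJ (treeDelta []) Y)).continuousAt.tendsto.comp hcurve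
    refine tendsto_nhds_unique h1 (h2.congr' ?_)
    filter_upwards [self_mem_nhdsWithin] with t ht
    refine (hμ.treeL_eq_of_im_ne_zero hd hκ hJs hJ ?_ Y).symm
    simpa [him] using ht
  · exact hμ.treeL_eq_of_im_ne_zero hd hκ hJs hJ him Y

end IsAngelescoSystem

end

theorem proposition4p2 {d : ℕ} (hd : 2 ≤ d) (μ : Fin d → Measure ℝ)
    (hμ : IsAngelescoSystem μ) (κ : Fin d → ℝ) (hκ : ∑ j, κ j = 1) :
    -- the polynomials, the recurrence coefficients and the weights are well defined
    (∀ n : Fin d → ℕ, (∃! P, IsTypeII μ n P) ∧ ∃! A, IsTypeI μ n A) ∧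
    (∃! c, IsRecurrenceCoeff μ c) ∧
    (∀ Y : TreeVertex d, 0 < treeW μ Y) ∧
    -- the Jacobi matrix is a bounded self-adjoint operator on the Hilbert space of the tree
    ∃ J : TreeL2 d →L[ℂ] TreeL2 d,
      IsSelfAdjoint J ∧
      (∀ (f : TreeL2 d) (Y : TreeVertex d), J f Y = jacobiAction μ κ (fun X => f X) Y) ∧
      ∀ z : ℂ, (∀ j, z ∉ (fun x : ℝ => (x : ℂ)) '' (μ j).support) → z ∉ spectrum ℂ J →
        (∃ l : TreeL2 d, (∀ Y, l Y = treeL μ z Y) ∧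
          l = gammaMarkov μ κ z • opResolvent J z (treeDelta [])) ∧
        gammaMarkov μ κ z ≠ 0 ∧
        ∀ Y : TreeVertex d,
          greenFunction J Y [] z = (gammaMarkov μ κ z)⁻¹ * treeL μ z Y := by
  refine ⟨fun n => ⟨hμ.existsUnique_typeII n, hμ.existsUnique_typeI n⟩,
    hμ.existsUnique_recurrenceCoeff hd, hμ.treeW_pos hd, ?_⟩
  obtain ⟨J, hJs, hJ⟩ := hμ.exists_jacobi hd κ
  refine ⟨J, hJs, hJ, fun z hz hzJ => ?_⟩
  have hL := hμ.treeL_eq_gammaMarkov_mul hd hκ hJs hJ hz hzJ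
  have hne : gammaMarkov μ κ z ≠ 0 := by
    intro h0
    obtain ⟨Y, hY⟩ := hμ.exists_treeL_ne_zero hd hz
    exact hY (by rw [hL, h0, zero_mul])
  -- The resolvent vector itself is taken as `l`, so membership in `ℓ²` is automatic and only the
  -- equality at each vertex is left.
  refine ⟨⟨_, fun Y => ?_, rfl⟩, hne, fun Y => ?_⟩
  · rw [hL]; rfl
  · rw [hL, inv_mul_cancel_left₀ hne, greenFunction, inner_treeDelta]
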